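/- Let $0<\lambda_1<\lambda_2<\dots$ be real numbers with $\sum_{n\ge1}1/\lambda_n<\infty$, and let $M^1_\Lambda$ be the closed linear span of the functions $x^{\lambda_n}$, $n\ge 1$, in the complex space $L^1=L^1([0,1])$ (Lebesgue measure). Each element of $M^1_\Lambda$ has a unique representative that is continuous on $[0,1)$, and is identified with it. Let $\phi:[0,1]\to[0,1]$ be a measurable function satisfying condition $(\alpha)$: (a) the set $\phi^{-1}(1)=\{x_1,\dots,x_p\}$ is finite (possibly empty); there is an $\epsilon>0$ such that (b) for each $i$, $\phi$ is $C^1$ on $[x_i-\epsilon,x_i]\cap[0,1]$ and on $[x_i,x_i+\epsilon]\cap[0,1]$, and (d) for some $\alpha<1$, $\phi(x)\le\alpha$ for all $x\in[0,1]\setminus\bigcup_{i}(x_i-\epsilon,x_i+\epsilon)$; and (c) for each $i$, the left derivative satisfies $\phi'_-(x_i)>0$ if $x_i>0$, and the right derivative satisfies $\phi'_+(x_i)<0$ if $x_i<1$. Let $\psi:[0,1]\to\mathbb C$ be continuous. Then the weighted composition operator $\mathcal T_\psi\circ C_\phi: f\mapsto \psi\cdot(f\circ\phi)$ is well defined and bounded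 from $M^1_\Lambda$ to $L^1$, and its essential norm, that is $\inf\{\|\mathcal T_\psi\circ C_\phi-K\| : K:M^1_\Lambda\to L^1 \text{ compact linear}\}$, equals $$\|\mathcal T_\psi\circ C_\phi\|_e=\sum_{i=1}^p|\psi(x_i)|\,L(x_i),\qquad L(x_i)=\begin{cases}\dfrac1{\phi'_-(x_i)}+\dfrac1{|\phi'_+(x_i)|}&\text{if }x_i\in(0,1),\\[2mm] \dfrac1{\phi'_-(x_i)}&\text{if }x_i=1,\\[2mm] \dfrac1{|\phi'_+(x_i)|}&\text{if }x_i=0.\end{cases}$$ -/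

import Mathlib

open MeasureTheory Set

noncomputable section

/-- Lebesgue measure on the interval `[0,1]`. -/
abbrev unitMeasure : Measure ℝ := volume.restrict (Icc (0 : ℝ) 1)

/-- The complex Banach space `L¹([0,1])`. -/
abbrev L1Unit : Type := Lp ℂ 1 unitMeasure

/-- The Müntz space of a sequence of exponents `Λ`: the closed linear span in `L¹([0,1])` of (the
classes of) the functions `x ↦ x ^ Λ n`. -/
def muntzSpace (Λ : ℕ → ℝ) : Submodule ℂ L1Unit :=
  (Submodule.span ℂ {f : L1Unit | ∃ n : ℕ, f =ᵐ[unitMeasure] fun x : ℝ => ((x ^ Λ n : ℝ) : ℂ)}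
    ).topologicalClosure

/-- The fibre `{x ∈ [0,1] : φ x = 1}`. -/
def fibreOne (φ : ℝ → ℝ) : Set ℝ := {x | x ∈ Icc (0 : ℝ) 1 ∧ φ x = 1}

/-- The left derivative of `φ` at `x`. -/
def leftDeriv (φ : ℝ → ℝ) (x : ℝ) : ℝ := derivWithin φ (Iic x) x

/-- The right derivative of `φ` at `x`. -/
def rightDeriv (φ : ℝ → ℝ) (x : ℝ) : ℝ := derivWithin φ (Ici x) x

/-- Condition `(α)` for a function `φ : [0,1] → [0,1]`, represented by a function on `ℝ` of which
only the values on `[0,1]` matter: intervals around a point of the fibre are intersected with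
`[0,1]`, and at an endpoint of `[0,1]` only the one-sided derivative from inside is considered. -/
structure ConditionAlpha (φ : ℝ → ℝ) : Prop where
  mapsTo : MapsTo φ (Icc 0 1) (Icc 0 1)
  /-- Lebesgue measurability on `[0,1]`; every Borel function satisfies this. -/
  aemeasurable : AEMeasurable φ unitMeasure
  finite_fibre : (fibreOne φ).Finite
  leftDeriv_pos : ∀ x ∈ fibreOne φ, 0 < x → 0 < leftDeriv φ x
  rightDeriv_neg : ∀ x ∈ fibreOne φ, x < 1 → rightDeriv φ x < 0
  exists_radius : ∃ ε : ℝ, 0 < ε ∧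
    (∀ x ∈ fibreOne φ, ContDiffOn ℝ 1 φ (Icc (x - ε) x ∩ Icc 0 1) ∧
      ContDiffOn ℝ 1 φ (Icc x (x + ε) ∩ Icc 0 1)) ∧
    ∃ α : ℝ, α < 1 ∧ ∀ y ∈ Icc (0 : ℝ) 1,
      y ∉ (⋃ x ∈ fibreOne φ, Ioo (x - ε) (x + ε)) → φ y ≤ α

/-- The sum `L(x)` of the reciprocals of the absolute values of the one-sided derivatives of `φ`
at `x` that make sense on `[0,1]`. -/
def reciprocalSlopes (φ : ℝ → ℝ) (x : ℝ) : ℝ :=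
  if x = 0 then 1 / |rightDeriv φ x|
  else if x = 1 then 1 / leftDeriv φ x
  else 1 / leftDeriv φ x + 1 / |rightDeriv φ x|

/-- `T` is the weighted composition operator `f ↦ ψ · (f ∘ φ)` from the Müntz space to `L¹([0,1])`.
An element `f` of the Müntz space is, as a function, its continuous representative `g` on `[0,1)`
(which is unique on `[0,1)`; the composition does not make sense for almost everywhere classes,
since `φ` may be constant on a set of positive measure). The value of `g` at `1` is immaterial
when `φ` takes the value `1` on a null set only. -/
def IsWeightedComposition (Λ : ℕ → ℝ) (φ : ℝ → ℝ) (ψ : ℝ → ℂ)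
    (T : muntzSpace Λ →L[ℂ] L1Unit) : Prop :=
  ∀ f : muntzSpace Λ, ∃ g : ℝ → ℂ, ContinuousOn g (Ico 0 1) ∧
    (f : L1Unit) =ᵐ[unitMeasure] g ∧ T f =ᵐ[unitMeasure] fun x => ψ x * g (φ x)

/-- The essential norm of a bounded operator: its distance to the compact operators. -/
def essentialNorm {E F : Type*} [NormedAddCommGroup E] [NormedSpace ℂ E]
    [NormedAddCommGroup F] [NormedSpace ℂ F] (T : E →L[ℂ] F) : ℝ :=
  ⨅ K : {K : E →L[ℂ] F // IsCompactOperator K}, ‖T - (K : E →L[ℂ] F)‖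

end

open MeasureTheory Set
open Filter Topology Complex

/-! The mechanism is a splitting of `[0,1]` into a small neighbourhood of the fibre over `1` and the
rest. Off the neighbourhood `φ` stays below some `a < 1`, and restriction of a Müntz space to
`[0,a]` is compact into `C([0,a])`, so that part of the operator is compact. Near the fibre the
change of variables `u = φ y` on each side of each `x_i` pushes `|ψ| dy` forward to a measure whose
density near `u = 1` is close to `∑ |ψ(x_i)| L(x_i)`. This bounds the remaining part from above
(`exists_compact_norm_sub_le`). Conversely, the normalized powers `(λ_n + 1) x ^ λ_n` have all their
mass escaping to `1`, so near the fibre their images keep norm at least about this sum, while a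
compact operator sends a subsequence to a limit with little mass on a small set
(`le_norm_sub_of_isCompactOperator`).

The analytic core is `exists_modulus`: on `[0,a]`, Müntz polynomials are bounded and equicontinuous
in terms of their `L¹` norm. For `p = ∑ c_n x ^ λ_n` and `R(q) = ∑ c_n / (λ_n - q)`, Cauchy's
formula writes `2πi p(x)` as the integral of `R(q) x ^ q` along the rays `r (1 ± i)`. The `L¹` norm
bounds `R` on the line `Re q = -1`. A Blaschke product carries this bound to the rays, with a loss
that is subexponential because `∑ 1/λ_n` converges. The decay of `x ^ q` for `x ≤ a < 1` absorbs the
loss. -/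

/-! ### Bounds for sums of simple fractions on the rays through `1 ± i` -/

/-- Multiplication by the Blaschke product with zeros `w i` removes the poles and changes no modulus
on the imaginary axis. Phragmén–Lindelöf then gives the bound `A` in the right half-plane, and
dividing by the Blaschke product gives the claim. -/
theorem norm_sum_div_sub_le_mul_prod {ι : Type*} [DecidableEq ι] (s : Finset ι) (w : ι → ℝ)
    (hw : ∀ i ∈ s, 0 < w i) (c : ι → ℂ) {A : ℝ}
    (hA : ∀ y : ℝ, ‖∑ i ∈ s, c i / ((w i : ℂ) + y * I)‖ ≤ A) {ζ : ℂ} (hζ : 0 ≤ ζ.re)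
    (hne : ∀ i ∈ s, ζ ≠ w i) :
    ‖∑ i ∈ s, c i / ((w i : ℂ) - ζ)‖ ≤ A * ∏ i ∈ s, (‖(w i : ℂ) + ζ‖ / ‖(w i : ℂ) - ζ‖) := by
  have hadd : ∀ z : ℂ, 0 ≤ z.re → ∀ i ∈ s, (w i : ℂ) + z ≠ 0 := by
    intro z hz i hi h
    have := congrArg Complex.re h
    simp at this
    linarith [hw i hi]
  have hfac : ∀ z : ℂ, 0 ≤ z.re → ∀ i ∈ s, ‖((w i : ℂ) - z) / (w i + z)‖ ≤ 1 := by
    intro z hz i hi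
    rw [norm_div, div_le_one (norm_pos_iff.2 (hadd z hz i hi))]
    rw [← sq_le_sq₀ (norm_nonneg _) (norm_nonneg _), ← Complex.normSq_eq_norm_sq,
      ← Complex.normSq_eq_norm_sq, Complex.normSq_apply, Complex.normSq_apply]
    simp
    nlinarith [mul_nonneg hz (hw i hi).le]
  -- The `i`-th Blaschke factor is already cancelled against `w i - z`, so `P` is holomorphic at the
  -- poles too.
  set P : ℂ → ℂ := fun z => ∑ i ∈ s, c i / ((w i : ℂ) + z) *
    ∏ j ∈ s.erase i, (((w j : ℂ) - z) / (w j + z)) with hP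
  have hPeq : ∀ z : ℂ, 0 ≤ z.re → (∀ i ∈ s, z ≠ w i) →
      P z = (∑ i ∈ s, c i / ((w i : ℂ) - z)) * ∏ j ∈ s, (((w j : ℂ) - z) / (w j + z)) := by
    intro z hz hn
    simp only [hP, Finset.sum_mul]
    refine Finset.sum_congr rfl fun i hi => ?_
    rw [← Finset.mul_prod_erase s _ hi, ← mul_assoc]
    congr 1
    have h1 := hadd z hz i hi
    have h2 : (w i : ℂ) - z ≠ 0 := sub_ne_zero.2 (hn i hi).symm
    field_simp
  have hdiff : ∀ z : ℂ, 0 ≤ z.re → DifferentiableAt ℂ P z := by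
    intro z hz
    refine DifferentiableAt.fun_sum fun i hi => ?_
    refine DifferentiableAt.mul ?_ ?_
    · exact (differentiableAt_const _).div (by fun_prop) (hadd z hz i hi)
    · refine DifferentiableAt.fun_finsetProd fun j hj => ?_
      exact DifferentiableAt.div (by fun_prop) (by fun_prop)
        (hadd z hz j (Finset.mem_of_mem_erase hj))
  have hprod : ∀ z : ℂ, 0 ≤ z.re → ∀ i, ‖∏ j ∈ s.erase i, (((w j : ℂ) - z) / (w j + z))‖ ≤ 1 := by
    intro z hz i
    rw [norm_prod]
    exact Finset.prod_le_one (fun _ _ => norm_nonneg _)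
      fun j hj => hfac z hz j (Finset.mem_of_mem_erase hj)
  have hbd : ∀ z : ℂ, 0 ≤ z.re → ‖P z‖ ≤ ∑ i ∈ s, ‖c i‖ / ‖(w i : ℂ) + z‖ := by
    intro z hz
    refine (norm_sum_le _ _).trans (Finset.sum_le_sum fun i hi => ?_)
    rw [norm_mul, norm_div]
    exact mul_le_of_le_one_right (by positivity) (hprod z hz i)
  have key : ∀ z : ℂ, 0 ≤ z.re → ‖P z‖ ≤ A := by
    intro z hz
    refine PhragmenLindelof.right_half_plane_of_tendsto_zero_on_real (f := P) ?_
      ⟨1, by norm_num, 0, ?_⟩ ?_ ?_ hz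
    · refine DifferentiableOn.diffContOnCl fun y hy => (hdiff y ?_).differentiableWithinAt
      rwa [Complex.closure_setOfPred_lt_re] at hy
    · refine Asymptotics.IsBigO.of_bound (∑ i ∈ s, ‖c i‖ / w i) ?_
      filter_upwards [mem_inf_of_right (mem_principal_self {z : ℂ | 0 < z.re})] with y hy
      have hy' : 0 < y.re := hy
      simp only [zero_mul, Real.exp_zero, norm_one, mul_one]
      refine (hbd y hy'.le).trans (Finset.sum_le_sum fun i hi => ?_)
      refine div_le_div_of_nonneg_left (norm_nonneg _) (hw i hi) ?_
      refine le_trans ?_ (Complex.re_le_norm _)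
      simp [hy'.le]
    · rw [tendsto_zero_iff_norm_tendsto_zero]
      refine squeeze_zero' (g := fun x : ℝ => ∑ i ∈ s, ‖c i‖ / x) (Eventually.of_forall fun _ => norm_nonneg _) ?_ ?_
      · filter_upwards [eventually_gt_atTop 0] with x hx
        refine (hbd x (by simpa using hx.le)).trans (Finset.sum_le_sum fun i hi => ?_)
        refine div_le_div_of_nonneg_left (norm_nonneg _) hx ?_
        refine le_trans ?_ (Complex.re_le_norm _)
        simp [(hw i hi).le]
      · rw [show (0:ℝ) = ∑ i ∈ s, 0 by simp]
        exact tendsto_finsetSum _ fun i _ => tendsto_const_nhds.div_atTop tendsto_id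
    · intro y
      rw [hPeq _ (by simp), norm_mul, norm_prod]
      · have h1 := hA (-y)
        rw [Finset.prod_eq_one, mul_one]
        · simpa [sub_eq_add_neg] using h1
        · intro i hi
          have h2 := hadd (y * I) (by simp) i hi
          rw [norm_div, div_eq_one_iff_eq (norm_ne_zero_iff.2 h2)]
          rw [← sq_eq_sq₀ (norm_nonneg _) (norm_nonneg _), ← Complex.normSq_eq_norm_sq,
            ← Complex.normSq_eq_norm_sq, Complex.normSq_apply, Complex.normSq_apply]
          simp
      · intro i hi h
        have := congrArg Complex.re h
        simp at this
        linarith [hw i hi]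
  have h := key ζ hζ
  rw [hPeq ζ hζ hne, norm_mul, norm_prod] at h
  have hpos : 0 < ∏ i ∈ s, (‖(w i : ℂ) + ζ‖ / ‖(w i : ℂ) - ζ‖) :=
    Finset.prod_pos fun i hi => div_pos (norm_pos_iff.2 (hadd ζ hζ i hi))
      (norm_pos_iff.2 (sub_ne_zero.2 (hne i hi).symm))
  refine le_trans (le_of_eq ?_) (mul_le_mul_of_nonneg_right h hpos.le)
  rw [mul_assoc, ← Finset.prod_mul_distrib, Finset.prod_eq_one, mul_one]
  intro i hi
  have h1 := norm_ne_zero_iff.2 (hadd ζ hζ i hi)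
  have h2 := norm_ne_zero_iff.2 (sub_ne_zero.2 (hne i hi).symm)
  rw [norm_div]
  field_simp

/-- A canonical product over a sequence with `∑ 1/Λ n < ∞` has exponential type zero. For the
finitely many indices in `F`, `1 + t ≤ δ⁻¹ exp (δ t)`; for the others `1 + t ≤ exp t`, and their
reciprocals sum to little. -/
theorem exists_prod_one_add_le_mul_exp {Λ : ℕ → ℝ} (hpos : ∀ n, 0 < Λ n)
    (hsum : Summable fun n => 1 / Λ n) {ε : ℝ} (hε : 0 < ε) :
    ∃ C : ℝ, 0 < C ∧ ∀ (s : Finset ℕ) (r : ℝ), 0 ≤ r →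
      ∏ n ∈ s, (1 + 4 * (1 + r) / Λ n) ≤ C * Real.exp (ε * r) := by
  classical
  set S := ∑' n, 1 / Λ n with hS
  have hS0 : 0 ≤ S := tsum_nonneg fun n => (one_div_pos.2 (hpos n)).le
  obtain ⟨F, hF⟩ := summable_iff_vanishing_norm.1 hsum (ε / 8) (by positivity)
  -- Both parts of the exponent are then at most `4 (1 + r) ε / 8`, with total `ε (1 + r)`; this
  -- explains the factor `exp ε` in `C`.
  set δ := min 1 (ε / (8 * (S + 1))) with hδ
  have hδ0 : 0 < δ := by positivity
  have hδ1 : δ ≤ 1 := min_le_left _ _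
  have hδS : δ * S ≤ ε / 8 := by
    have h1 : δ ≤ ε / (8 * (S + 1)) := min_le_right _ _
    calc δ * S ≤ ε / (8 * (S + 1)) * (S + 1) := by gcongr; linarith
      _ = ε / 8 := by field_simp
  refine ⟨(δ⁻¹) ^ F.card * Real.exp ε, by positivity, fun s r hr => ?_⟩
  have hfac : ∀ n ∈ s, 1 + 4 * (1 + r) / Λ n ≤ (if n ∈ F then δ⁻¹ else 1) *
      Real.exp (4 * (1 + r) * (δ * (1 / Λ n) + if n ∈ F then 0 else 1 / Λ n)) := by
    intro n _
    have hn := one_div_pos.2 (hpos n)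
    have hx : 0 ≤ 4 * (1 + r) * (1 / Λ n) := by positivity
    have e : 4 * (1 + r) / Λ n = 4 * (1 + r) * (1 / Λ n) := by ring
    rw [e]
    split_ifs with h
    · rw [add_zero, inv_mul_eq_div, le_div_iff₀ hδ0]
      refine le_trans ?_ (Real.add_one_le_exp _)
      nlinarith
    · rw [one_mul]
      refine le_trans ?_ (Real.add_one_le_exp _)
      nlinarith [mul_nonneg (mul_nonneg (by positivity : (0:ℝ) ≤ 4 * (1 + r)) hδ0.le) hn.le]
  refine (Finset.prod_le_prod (fun n _ => ?_) hfac).trans ?_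
  · have := hpos n
    positivity
  rw [Finset.prod_mul_distrib, ← Real.exp_sum, ← Finset.mul_sum, Finset.sum_add_distrib,
    ← Finset.mul_sum, mul_assoc (δ⁻¹ ^ F.card), ← Real.exp_add]
  refine mul_le_mul ?_ (Real.exp_le_exp.2 ?_) (Real.exp_pos _).le (by positivity)
  · rw [Finset.prod_ite, Finset.prod_const, Finset.prod_const_one, mul_one]
    refine pow_le_pow_right₀ ((one_le_inv₀ hδ0).2 hδ1) (Finset.card_le_card fun n hn => ?_)
    exact (Finset.mem_filter.1 hn).2
  · have h1 : ∑ n ∈ s, 1 / Λ n ≤ S :=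
      hsum.sum_le_tsum s fun n _ => (one_div_pos.2 (hpos n)).le
    have h2 : ∑ n ∈ s, (if n ∈ F then 0 else 1 / Λ n) ≤ ε / 8 := by
      rw [Finset.sum_ite, Finset.sum_const_zero, zero_add]
      refine (le_abs_self _).trans (hF _ ?_).le
      exact Finset.disjoint_left.2 fun n hn => (Finset.mem_filter.1 hn).2
    have h3 : δ * ∑ n ∈ s, 1 / Λ n ≤ ε / 8 :=
      (mul_le_mul_of_nonneg_left h1 hδ0.le).trans hδS
    calc 4 * (1 + r) * (δ * ∑ n ∈ s, 1 / Λ n + ∑ n ∈ s, (if n ∈ F then 0 else 1 / Λ n))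
        ≤ 4 * (1 + r) * (ε / 8 + ε / 8) := by gcongr
      _ = ε + ε * r := by ring

theorem norm_sub_sq_of_diag {q : ℂ} {r : ℝ} (hre : q.re = r) (him : |q.im| = r) (l : ℝ) :
    ‖(l : ℂ) - q‖ ^ 2 = (l - r) ^ 2 + r ^ 2 := by
  rw [← Complex.normSq_eq_norm_sq, Complex.normSq_apply]
  have := sq_abs q.im
  rw [him] at this
  simp [hre]
  nlinarith

theorem le_two_mul_norm_sub_of_diag {q : ℂ} {r l : ℝ} (hre : q.re = r) (him : |q.im| = r)
    (hl : 0 ≤ l) : l + r ≤ 4 * ‖(l : ℂ) - q‖ := by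
  have hr : 0 ≤ r := him ▸ abs_nonneg _
  have h := norm_sub_sq_of_diag hre him l
  rw [← sq_le_sq₀ (by positivity) (by positivity), mul_pow, h]
  nlinarith [sq_nonneg (l - 2 * r), sq_nonneg (l - r)]

/-- On the rays `q = r (1 ± i)` the distance from `q` to a positive `l` is comparable to `l + r`, so
no pole comes close and each inverse Blaschke factor is `1 + O((1 + r) / l)`. -/
theorem norm_add_div_norm_sub_le {q : ℂ} {r l : ℝ} (hre : q.re = r) (him : |q.im| = r)
    (hl : 0 < l) : ‖((l + 1 : ℝ) : ℂ) + (1 + q)‖ / ‖((l + 1 : ℝ) : ℂ) - (1 + q)‖ ≤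
      1 + 4 * (1 + r) / l := by
  have hr : 0 ≤ r := him ▸ abs_nonneg _
  have h := norm_sub_sq_of_diag hre him l
  have hpos : 0 < ‖(l : ℂ) - q‖ := by
    have := le_two_mul_norm_sub_of_diag hre him hl.le
    linarith
  have e1 : ((l + 1 : ℝ) : ℂ) - (1 + q) = l - q := by push_cast; ring
  have e2 : ((l + 1 : ℝ) : ℂ) + (1 + q) = (l - q) + 2 * (1 + q) := by push_cast; ring
  have h1 : ‖1 + q‖ * l ≤ 2 * (1 + r) * ‖(l : ℂ) - q‖ := by
    rw [← sq_le_sq₀ (by positivity) (by positivity), mul_pow, mul_pow, h,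
      ← Complex.normSq_eq_norm_sq, Complex.normSq_apply]
    have := sq_abs q.im
    rw [him] at this
    simp only [Complex.add_re, Complex.one_re, Complex.add_im, Complex.one_im, hre, zero_add]
    have e : (1 + r) * (1 + r) + q.im * q.im ≤ 2 * (1 + r) ^ 2 := by nlinarith
    have e' : l ^ 2 ≤ 2 * ((l - r) ^ 2 + r ^ 2) := by nlinarith [sq_nonneg (l - 2 * r)]
    calc ((1 + r) * (1 + r) + q.im * q.im) * l ^ 2
        ≤ (2 * (1 + r) ^ 2) * (2 * ((l - r) ^ 2 + r ^ 2)) := by gcongr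
      _ = _ := by ring
  rw [e1, e2]
  calc ‖(l : ℂ) - q + 2 * (1 + q)‖ / ‖(l : ℂ) - q‖
      ≤ (‖(l : ℂ) - q‖ + 2 * ‖1 + q‖) / ‖(l : ℂ) - q‖ := by
        gcongr
        refine (norm_add_le _ _).trans ?_
        simp
    _ = 1 + 2 * ‖1 + q‖ / ‖(l : ℂ) - q‖ := by field_simp
    _ ≤ 1 + 4 * (1 + r) / l := by
        gcongr 1 + ?_
        rw [div_le_div_iff₀ hpos hl]
        linarith

/-- The Laplace-type transform of a Müntz polynomial on the rays `r (1 ± i)` is controlled by its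
`L¹` norm. -/
theorem norm_sum_div_sub_le_of_diag {Λ : ℕ → ℝ} (hpos : ∀ n, 0 < Λ n) (s : Finset ℕ) (c : ℕ → ℂ)
    {q : ℂ} {r : ℝ} (hre : q.re = r) (him : |q.im| = r) :
    ‖∑ n ∈ s, c n / ((Λ n : ℂ) - q)‖ ≤
      (∫ x in (0:ℝ)..1, ‖∑ n ∈ s, c n * ((x ^ Λ n : ℝ) : ℂ)‖) *
        ∏ n ∈ s, (1 + 4 * (1 + r) / Λ n) := by
  have hr : 0 ≤ r := him ▸ abs_nonneg _
  have hcont : ∀ n, Continuous fun x : ℝ => ((x ^ Λ n : ℝ) : ℂ) := fun n =>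
    Complex.continuous_ofReal.comp (Real.continuous_rpow_const (hpos n).le)
  -- The sum is `∫ x ^ (iy) p(x) dx` with `|x ^ (iy)| = 1`. The integral shifts the exponents by
  -- one, so the half-plane bound is applied at `1 + q` with poles `Λ n + 1`.
  have hA : ∀ y : ℝ, ‖∑ n ∈ s, c n / (((Λ n + 1 : ℝ) : ℂ) + y * I)‖ ≤
      ∫ x in (0:ℝ)..1, ‖∑ n ∈ s, c n * ((x ^ Λ n : ℝ) : ℂ)‖ := by
    intro y
    have h1 : ∀ n, ∫ x in (0:ℝ)..1, (x:ℂ) ^ ((Λ n : ℂ) + y * I) =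
        1 / (((Λ n + 1 : ℝ) : ℂ) + y * I) := by
      intro n
      have hh := hpos n
      rw [integral_cpow (Or.inl (by simp; linarith))]
      have hne : (Λ n : ℂ) + y * I + 1 ≠ 0 := by
        intro h
        have := congrArg Complex.re h
        simp at this
        linarith
      rw [Complex.ofReal_zero, Complex.zero_cpow hne, Complex.ofReal_one, Complex.one_cpow,
        sub_zero]
      congr 1
      push_cast; ring
    have h2 : ∑ n ∈ s, c n / (((Λ n + 1 : ℝ) : ℂ) + y * I) =
        ∫ x in (0:ℝ)..1, ∑ n ∈ s, c n * (x:ℂ) ^ ((Λ n : ℂ) + y * I) := by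
      rw [intervalIntegral.integral_finsetSum]
      · refine Finset.sum_congr rfl fun n _ => ?_
        rw [intervalIntegral.integral_const_mul, h1]
        ring
      · intro n _
        refine (intervalIntegral.intervalIntegrable_cpow' ?_).const_mul _
        simp; linarith [hpos n]
    rw [h2]
    refine (intervalIntegral.norm_integral_le_integral_norm zero_le_one).trans (le_of_eq ?_)
    refine intervalIntegral.integral_congr_ae (Eventually.of_forall fun x hx => ?_)
    rw [uIoc_of_le zero_le_one] at hx
    have hx0 : (x:ℂ) ≠ 0 := by exact_mod_cast hx.1.ne'
    have : ∑ n ∈ s, c n * (x:ℂ) ^ ((Λ n : ℂ) + y * I) =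
        (x:ℂ) ^ ((y : ℂ) * I) * ∑ n ∈ s, c n * ((x ^ Λ n : ℝ) : ℂ) := by
      rw [Finset.mul_sum]
      refine Finset.sum_congr rfl fun n _ => ?_
      rw [Complex.cpow_add _ _ hx0, Complex.ofReal_cpow hx.1.le]
      ring
    rw [this, norm_mul, Complex.norm_cpow_eq_rpow_re_of_pos hx.1]
    simp
  have hsub : ∀ n, ((Λ n + 1 : ℝ) : ℂ) - (1 + q) = Λ n - q := by
    intro n; push_cast; ring
  have key := norm_sum_div_sub_le_mul_prod s (fun n => Λ n + 1)
    (fun n _ => by linarith [hpos n]) c hA (ζ := 1 + q) (by simp [hre]; linarith) ?_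
  · simp only [hsub] at key
    refine key.trans ?_
    gcongr with n hn
    · exact intervalIntegral.integral_nonneg zero_le_one fun x _ => norm_nonneg _
    · have := norm_add_div_norm_sub_le hre him (hpos n)
      rwa [hsub] at this
  · intro n _ h
    have h0 : (Λ n : ℂ) - q = 0 := by rw [← hsub n, ← h, sub_self]
    have := le_two_mul_norm_sub_of_diag hre him (hpos n).le
    rw [h0, norm_zero] at this
    linarith [hpos n]

theorem diag_re (r : ℝ) : ((r : ℂ) * (1 + I)).re = r := by simp

theorem abs_diag_im {r : ℝ} (hr : 0 ≤ r) : |((r : ℂ) * (1 + I)).im| = r := by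
  simp [abs_of_nonneg hr]

theorem diag_conj_re (r : ℝ) : ((r : ℂ) * (1 - I)).re = r := by simp

theorem abs_diag_conj_im {r : ℝ} (hr : 0 ≤ r) : |((r : ℂ) * (1 - I)).im| = r := by
  simp [abs_of_nonneg hr]

theorem norm_one_add_I_le : ‖(1 + I : ℂ)‖ ≤ 2 := by
  refine (norm_add_le _ _).trans ?_
  simp; norm_num

theorem norm_one_sub_I_le : ‖(1 - I : ℂ)‖ ≤ 2 := by
  refine (norm_sub_le _ _).trans ?_
  simp; norm_num

/-! ### Powers as integrals along the two rays -/

/-- The integrand of the representation of `exp (-l L)` by resolvents on a ray. -/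
noncomputable def rayKernel (l L r : ℝ) : ℂ :=
  (1 + I) * cexp (-((r : ℂ) * (1 + I)) * L) / ((l : ℂ) - r * (1 + I))

theorem sub_diag_ne_zero {l r : ℝ} (hl : 0 < l) (hr : 0 ≤ r) : (l : ℂ) - r * (1 + I) ≠ 0 := by
  intro h
  have := le_two_mul_norm_sub_of_diag (diag_re r) (abs_diag_im hr) hl.le
  rw [h, norm_zero] at this
  linarith

theorem norm_rayKernel_le {l L r : ℝ} (hl : 0 < l) (hr : 0 ≤ r) :
    ‖rayKernel l L r‖ ≤ 8 * Real.exp (-(r * L)) / (l + r) := by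
  have h := le_two_mul_norm_sub_of_diag (diag_re r) (abs_diag_im hr) hl.le
  have h0 := norm_pos_iff.2 (sub_diag_ne_zero hl hr)
  rw [rayKernel, norm_div, norm_mul, Complex.norm_exp, div_le_div_iff₀ h0 (by positivity)]
  have e : (-((r : ℂ) * (1 + I)) * L).re = -(r * L) := by simp
  rw [e]
  have := Real.exp_pos (-(r * L))
  calc ‖(1 + I : ℂ)‖ * Real.exp (-(r * L)) * (l + r)
      ≤ 2 * Real.exp (-(r * L)) * (4 * ‖(l : ℂ) - r * (1 + I)‖) := by
        gcongr
        exact norm_one_add_I_le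
    _ = _ := by ring

theorem measurable_rayKernel (l : ℝ) : Measurable fun p : ℝ × ℝ => rayKernel l p.1 p.2 := by
  unfold rayKernel
  fun_prop

theorem integrableOn_rayKernel {l L : ℝ} (hl : 0 < l) (hL : 0 < L) :
    IntegrableOn (rayKernel l L) (Ioi 0) := by
  have h1 : IntegrableOn (fun r => 8 / l * Real.exp (-L * r)) (Ioi 0) :=
    (exp_neg_integrableOn_Ioi 0 hL).const_mul _
  refine Integrable.mono' h1
    ((measurable_rayKernel l).comp measurable_prodMk_left).aestronglyMeasurable ?_
  filter_upwards [ae_restrict_mem measurableSet_Ioi] with r hr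
  have hr' : 0 < r := hr
  refine (norm_rayKernel_le hl hr'.le).trans ?_
  rw [div_mul_eq_mul_div]
  refine div_le_div₀ (by positivity) (le_of_eq ?_) hl (by linarith)
  ring_nf

/-- With `q = r (1 + i)`, differentiation in `L` brings down `-q`, and `-q / (l - q) = 1 - l / (l -
q)`. The first term integrates to `1 / L`. -/
theorem hasDerivAt_integral_rayKernel {l L : ℝ} (hl : 0 < l) (hL : 0 < L) :
    HasDerivAt (fun L => ∫ r in Ioi 0, rayKernel l L r)
      (1 / L - l * ∫ r in Ioi 0, rayKernel l L r) L := by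
  have hre : ∀ L : ℝ, 0 < L → ((-(1 + I) * L : ℂ)).re < 0 := fun L hL => by simpa using hL
  have hderiv : ∀ r L : ℝ, 0 < r → HasDerivAt (fun L => rayKernel l L r)
      ((1 + I) * cexp (-(1 + I) * L * r) - l * rayKernel l L r) L := by
    intro r L hr
    have h1 : HasDerivAt (fun L : ℝ => cexp (-((r : ℂ) * (1 + I)) * L))
        (cexp (-((r : ℂ) * (1 + I)) * L) * (-((r : ℂ) * (1 + I)))) L := by
      have := ((hasDerivAt_id (L : ℂ)).const_mul (-((r : ℂ) * (1 + I)))).cexp.comp_ofReal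
      simpa using this
    refine ((h1.const_mul (1 + I : ℂ)).div_const ((l : ℂ) - r * (1 + I))).congr_deriv ?_
    have h0 := sub_diag_ne_zero hl hr.le
    rw [rayKernel, show -(1 + I : ℂ) * L * r = -((r : ℂ) * (1 + I)) * L by ring, ← mul_div_assoc,
      eq_sub_iff_add_eq, ← add_div, div_eq_iff h0]
    ring
  have hmain := hasDerivAt_integral_of_dominated_loc_of_deriv_le
    (μ := volume.restrict (Ioi (0:ℝ))) (F := fun L r => rayKernel l L r)
    (F' := fun L r => (1 + I) * cexp (-(1 + I) * L * r) - l * rayKernel l L r)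
    (bound := fun r => 10 * Real.exp (-(L / 2) * r)) (x₀ := L) (s := Ioi (L / 2))
    (Ioi_mem_nhds (by linarith)) ?_ (integrableOn_rayKernel hl hL) ?_ ?_ ?_ ?_
  · refine hmain.2.congr_deriv ?_
    rw [integral_sub, integral_const_mul, integral_const_mul,
      integral_exp_mul_complex_Ioi (hre L hL)]
    · have h2 : (1 + I : ℂ) ≠ 0 := by
        intro h; simpa using congrArg Complex.re h
      have h3 : (L : ℂ) ≠ 0 := by exact_mod_cast hL.ne'
      simp only [Complex.ofReal_zero, mul_zero, Complex.exp_zero]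
      field_simp
    · exact (integrableOn_exp_mul_complex_Ioi (hre L hL) 0).const_mul _
    · exact (integrableOn_rayKernel hl hL).const_mul _
  · exact Eventually.of_forall fun L =>
      ((measurable_rayKernel l).comp measurable_prodMk_left).aestronglyMeasurable
  · refine Measurable.aestronglyMeasurable ?_
    refine Measurable.sub (by fun_prop) ?_
    exact ((measurable_rayKernel l).comp measurable_prodMk_left).const_mul _
  · filter_upwards [ae_restrict_mem measurableSet_Ioi] with r hr x hx
    have hr' : 0 < r := hr
    have hx' : L / 2 < x := hx
    have hE : Real.exp (-(r * x)) ≤ Real.exp (-(L / 2) * r) := by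
      apply Real.exp_le_exp.2
      nlinarith
    refine (norm_sub_le _ _).trans ?_
    have h1 : ‖(1 + I) * cexp (-(1 + I) * x * r)‖ ≤ 2 * Real.exp (-(L / 2) * r) := by
      rw [norm_mul, Complex.norm_exp]
      have e : (-(1 + I : ℂ) * x * r).re = -(r * x) := by simp; ring
      rw [e]
      exact mul_le_mul norm_one_add_I_le hE (Real.exp_pos _).le (by norm_num)
    have h2 : ‖(l : ℂ) * rayKernel l x r‖ ≤ 8 * Real.exp (-(L / 2) * r) := by
      rw [norm_mul, Complex.norm_real, Real.norm_of_nonneg hl.le]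
      calc l * ‖rayKernel l x r‖ ≤ l * (8 * Real.exp (-(r * x)) / (l + r)) := by
            gcongr; exact norm_rayKernel_le hl hr'.le
        _ = 8 * Real.exp (-(r * x)) * (l / (l + r)) := by ring
        _ ≤ 8 * Real.exp (-(L / 2) * r) * 1 := by
            gcongr
            rw [div_le_one (by positivity)]; linarith
        _ = _ := mul_one _
    linarith
  · exact (exp_neg_integrableOn_Ioi 0 (by linarith : 0 < L / 2)).const_mul _
  · filter_upwards [ae_restrict_mem measurableSet_Ioi] with r hr x _
    exact hderiv r x hr

/-- Since `1 / L` is real, the imaginary part solves `y' = -l y`. This replaces the residue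
computation up to the constant. -/
theorem exists_im_integral_rayKernel_eq {l : ℝ} (hl : 0 < l) :
    ∃ c : ℝ, ∀ L : ℝ, 0 < L → (∫ r in Ioi 0, rayKernel l L r).im = c * Real.exp (-(l * L)) := by
  set j : ℝ → ℝ := fun L => Real.exp (l * L) * (∫ r in Ioi 0, rayKernel l L r).im with hj
  have hd : ∀ L : ℝ, 0 < L → HasDerivAt j 0 L := by
    intro L hL
    have h1 := (Complex.imCLM.hasFDerivAt.comp_hasDerivAt L (hasDerivAt_integral_rayKernel hl hL))
    have h2 : HasDerivAt (fun L : ℝ => Real.exp (l * L)) (Real.exp (l * L) * l) L := by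
      simpa using ((hasDerivAt_id L).const_mul l).exp
    have h3 := h2.mul h1
    refine h3.congr_deriv ?_
    have : ((1 : ℂ) / L).im = 0 := by
      rw [← Complex.ofReal_one, ← Complex.ofReal_div, Complex.ofReal_im]
    simp [Complex.mul_im]
    ring
  refine ⟨j 1, fun L hL => ?_⟩
  have h := (isOpen_Ioi (a := (0:ℝ))).is_const_of_deriv_eq_zero isPreconnected_Ioi
    (fun L hL => (hd L hL).differentiableAt.differentiableWithinAt)
    (fun L hL => (hd L hL).deriv) hL (mem_Ioi.2 zero_lt_one)
  rw [← h]
  simp only [hj]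
  rw [mul_right_comm, ← Real.exp_add]
  simp

theorem integral_im_div_eq {l : ℝ} (hl : 0 < l) :
    IntegrableOn (fun r : ℝ => (l ^ 2 + 2 * r ^ 2) / (l ^ 4 + 4 * r ^ 4)) (Ioi 0) ∧
    ∫ r in Ioi (0:ℝ), (l ^ 2 + 2 * r ^ 2) / (l ^ 4 + 4 * r ^ 4) = Real.pi / (2 * l) := by
  -- Antiderivative from the factorization `l⁴ + 4r⁴ = (l² - 2lr + 2r²)(l² + 2lr + 2r²)`.
  set A : ℝ → ℝ := fun r => 1 / (2 * l) *
    (Real.arctan ((2 * r - l) / l) + Real.arctan ((2 * r + l) / l)) with hA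
  have hd : ∀ r : ℝ, HasDerivAt A ((l ^ 2 + 2 * r ^ 2) / (l ^ 4 + 4 * r ^ 4)) r := by
    intro r
    have h1 : HasDerivAt (fun r : ℝ => (2 * r - l) / l) (2 / l) r := by
      simpa using (((hasDerivAt_id r).const_mul 2).sub_const l).div_const l
    have h2 : HasDerivAt (fun r : ℝ => (2 * r + l) / l) (2 / l) r := by
      simpa using (((hasDerivAt_id r).const_mul 2).add_const l).div_const l
    refine ((h1.arctan.add h2.arctan).const_mul (1 / (2 * l))).congr_deriv ?_
    have p1 : 0 < l ^ 2 + (2 * r - l) ^ 2 := by positivity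
    have p2 : 0 < l ^ 2 + (2 * r + l) ^ 2 := by positivity
    have p3 : 0 < l ^ 4 + 4 * r ^ 4 := by positivity
    have e1 : 1 + ((2 * r - l) / l) ^ 2 = (l ^ 2 + (2 * r - l) ^ 2) / l ^ 2 := by field_simp
    have e2 : 1 + ((2 * r + l) / l) ^ 2 = (l ^ 2 + (2 * r + l) ^ 2) / l ^ 2 := by field_simp
    rw [e1, e2]
    field_simp
    ring
  have hlim : Tendsto A atTop (𝓝 (1 / (2 * l) * (Real.pi / 2 + Real.pi / 2))) := by
    refine Tendsto.const_mul _ (Tendsto.add ?_ ?_)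
    · refine (Real.tendsto_arctan_atTop.mono_right nhdsWithin_le_nhds).comp ?_
      exact (tendsto_atTop_add_const_right _ (-l)
        (tendsto_id.const_mul_atTop (by norm_num : (0:ℝ) < 2))).atTop_div_const hl
    · refine (Real.tendsto_arctan_atTop.mono_right nhdsWithin_le_nhds).comp ?_
      exact (tendsto_atTop_add_const_right _ l
        (tendsto_id.const_mul_atTop (by norm_num : (0:ℝ) < 2))).atTop_div_const hl
  have hA0 : A 0 = 0 := by
    simp only [hA, mul_zero, zero_sub, zero_add, neg_div, Real.arctan_neg]
    ring
  refine ⟨integrableOn_Ioi_deriv_of_nonneg' (fun r _ => hd r) (fun r _ => by positivity) hlim, ?_⟩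
  rw [integral_Ioi_of_hasDerivAt_of_nonneg' (fun r _ => hd r) (fun r _ => by positivity) hlim, hA0]
  field_simp
  ring

/-- The constant `c` is found by integrating against `exp (-l L)` over `L > 0`: one side gives `c /
(2l)`, and by Fubini the other is the rational integral of `integral_im_div_eq`, equal to `π /
(2l)`. -/
theorem im_integral_rayKernel {l L : ℝ} (hl : 0 < l) (hL : 0 < L) :
    (∫ r in Ioi 0, rayKernel l L r).im = Real.pi * Real.exp (-(l * L)) := by
  obtain ⟨c, hc⟩ := exists_im_integral_rayKernel_eq hl
  have hmeas : Measurable fun p : ℝ × ℝ => (Real.exp (-(l * p.1)) : ℂ) * rayKernel l p.1 p.2 :=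
    Measurable.mul (by fun_prop) (measurable_rayKernel l)
  have hre : ∀ r : ℝ, 0 < r → (-((l : ℂ) + r * (1 + I))).re < 0 := by
    intro r hr; simp; linarith
  have hform : ∀ r L : ℝ, (Real.exp (-(l * L)) : ℂ) * rayKernel l L r =
      (1 + I) / ((l : ℂ) - r * (1 + I)) * cexp (-((l : ℂ) + r * (1 + I)) * L) := by
    intro r L
    rw [rayKernel, Complex.ofReal_exp, show -((l : ℂ) + r * (1 + I)) * L =
      ((-(l * L) : ℝ) : ℂ) + (-((r : ℂ) * (1 + I)) * L) by push_cast; ring, Complex.exp_add]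
    ring
  have hint1 : ∀ r : ℝ, 0 < r → IntegrableOn
      (fun L : ℝ => (Real.exp (-(l * L)) : ℂ) * rayKernel l L r) (Ioi 0) := by
    intro r hr
    simp only [hform]
    exact (integrableOn_exp_mul_complex_Ioi (hre r hr) 0).const_mul _
  have hquad : IntegrableOn (fun r : ℝ => 16 * ((l ^ 2 + 2 * r ^ 2) / (l ^ 4 + 4 * r ^ 4))) (Ioi 0) :=
    (integral_im_div_eq hl).1.const_mul _
  have hint : Integrable (Function.uncurry fun L r : ℝ =>
      (Real.exp (-(l * L)) : ℂ) * rayKernel l L r)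
      ((volume.restrict (Ioi 0)).prod (volume.restrict (Ioi 0))) := by
    refine (integrable_prod_iff' hmeas.aestronglyMeasurable).2 ⟨?_, ?_⟩
    · filter_upwards [ae_restrict_mem measurableSet_Ioi] with r hr
      exact hint1 r hr
    · refine Integrable.mono' hquad ?_ ?_
      · exact (hmeas.norm.aestronglyMeasurable.prod_swap).integral_prod_right'
      · filter_upwards [ae_restrict_mem measurableSet_Ioi] with r hr
        have hr' : 0 < r := hr
        rw [Real.norm_of_nonneg (integral_nonneg fun _ => norm_nonneg _)]
        have hb : ∀ᵐ L ∂(volume.restrict (Ioi (0:ℝ))),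
            ‖(Real.exp (-(l * L)) : ℂ) * rayKernel l L r‖ ≤
              8 / (l + r) * Real.exp (-(l + r) * L) := by
          filter_upwards with L
          rw [norm_mul, Complex.norm_real, Real.norm_of_nonneg (Real.exp_pos _).le]
          calc Real.exp (-(l * L)) * ‖rayKernel l L r‖
              ≤ Real.exp (-(l * L)) * (8 * Real.exp (-(r * L)) / (l + r)) := by
                gcongr; exact norm_rayKernel_le hl hr'.le
            _ = 8 / (l + r) * (Real.exp (-(l * L)) * Real.exp (-(r * L))) := by ring
            _ = _ := by rw [← Real.exp_add]; ring_nf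
        have hlr : 0 < l + r := by linarith
        have hi := integral_exp_mul_Ioi (a := -(l + r)) (by linarith) 0
        calc ∫ L in Ioi 0, ‖(Real.exp (-(l * L)) : ℂ) * rayKernel l L r‖
            ≤ ∫ L in Ioi 0, 8 / (l + r) * Real.exp (-(l + r) * L) :=
              integral_mono_ae (hint1 r hr').norm
                ((exp_neg_integrableOn_Ioi 0 hlr).const_mul _) hb
          _ = 8 / (l + r) ^ 2 := by
              rw [integral_const_mul, hi, mul_zero, Real.exp_zero, neg_div_neg_eq]
              field_simp
          _ ≤ _ := by
              have h1 : 0 < l ^ 4 + 4 * r ^ 4 := by positivity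
              rw [← mul_div_assoc, div_le_div_iff₀ (by positivity) h1]
              nlinarith [mul_pos hl hr', sq_nonneg (l - r), mul_pos (mul_pos hl hr') (mul_pos hl hr'),
                pow_pos hl 4, pow_pos hr' 4, mul_pos (pow_pos hl 3) hr', mul_pos (pow_pos hr' 3) hl]
  have hswap := integral_integral_swap hint
  have hL1 : ∀ r : ℝ, 0 < r → ∫ L in Ioi 0, (Real.exp (-(l * L)) : ℂ) * rayKernel l L r =
      (1 + I) / ((l : ℂ) - r * (1 + I)) * (1 / ((l : ℂ) + r * (1 + I))) := by
    intro r hr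
    simp only [hform]
    rw [integral_const_mul, integral_exp_mul_complex_Ioi (hre r hr), Complex.ofReal_zero, mul_zero,
      Complex.exp_zero, neg_div_neg_eq]
  have him : ∀ r : ℝ, 0 < r → ((1 + I) / ((l : ℂ) - r * (1 + I)) *
      (1 / ((l : ℂ) + r * (1 + I)))).im = (l ^ 2 + 2 * r ^ 2) / (l ^ 4 + 4 * r ^ 4) := by
    intro r hr
    have h1 : (0:ℝ) < l ^ 4 + 4 * r ^ 4 := by positivity
    have h1' : (l : ℂ) ^ 4 + 4 * r ^ 4 ≠ 0 := by exact_mod_cast h1.ne'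
    have h2 := sub_diag_ne_zero hl hr.le
    have h3 : (l : ℂ) + r * (1 + I) ≠ 0 := by
      intro h
      have := congrArg Complex.re h
      simp at this
      linarith
    have : (1 + I) / ((l : ℂ) - r * (1 + I)) * (1 / ((l : ℂ) + r * (1 + I))) =
        (((l ^ 2 - 2 * r ^ 2) / (l ^ 4 + 4 * r ^ 4) : ℝ) : ℂ) +
        (((l ^ 2 + 2 * r ^ 2) / (l ^ 4 + 4 * r ^ 4) : ℝ) : ℂ) * I := by
      push_cast
      rw [div_mul_div_comm, mul_one, div_mul_eq_mul_div, ← add_div,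
        div_eq_div_iff (mul_ne_zero h2 h3) h1']
      linear_combination (3 * (l:ℂ) ^ 2 * r ^ 2 + (l:ℂ) ^ 2 * r ^ 2 * I + 2 * r ^ 4 + 2 * r ^ 4 * I) * Complex.I_sq
    rw [this]
    simp only [Complex.add_im, Complex.ofReal_im, Complex.im_ofReal_mul, Complex.I_im, mul_one,
      zero_add]
  have hright : (∫ r in Ioi 0, ∫ L in Ioi 0, (Real.exp (-(l * L)) : ℂ) * rayKernel l L r).im =
      Real.pi / (2 * l) := by
    have h1 := integral_im (𝕜 := ℂ) hint.integral_prod_right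
    simp only [Function.uncurry_apply_pair] at h1
    refine h1.symm.trans ?_
    rw [← (integral_im_div_eq hl).2]
    refine setIntegral_congr_fun measurableSet_Ioi fun r hr => ?_
    simp only [hL1 r hr]
    exact him r hr
  have hleft : (∫ L in Ioi 0, ∫ r in Ioi 0, (Real.exp (-(l * L)) : ℂ) * rayKernel l L r).im =
      c / (2 * l) := by
    have h1 := integral_im (𝕜 := ℂ) hint.integral_prod_left
    simp only [Function.uncurry_apply_pair] at h1
    refine h1.symm.trans ?_
    have : ∫ L in Ioi 0, c * Real.exp (-(2 * l) * L) = c / (2 * l) := by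
      rw [integral_const_mul, integral_exp_mul_Ioi (by linarith)]
      simp
      field_simp
    rw [← this]
    refine setIntegral_congr_fun measurableSet_Ioi fun L hL => ?_
    simp only [integral_const_mul]
    change (_ * _ : ℂ).im = _
    rw [Complex.im_ofReal_mul, hc L hL, mul_left_comm, ← Real.exp_add]
    ring_nf
  have hcpi : c = Real.pi := by
    have h := hleft.symm.trans ((congrArg Complex.im hswap).trans hright)
    field_simp at h
    linarith
  rw [hc L hL, hcpi]

/-- For `x = exp (-L)` the second ray contributes the complex conjugate of the first, so the
difference is `2i` times the imaginary part already computed. At `x = 0` both sides vanish. -/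
theorem integral_cpow_ray {l x : ℝ} (hl : 0 < l) (hx0 : 0 ≤ x) (hx1 : x < 1) :
    IntegrableOn (fun r : ℝ => (1 + I) * (x : ℂ) ^ ((r : ℂ) * (1 + I)) / ((l : ℂ) - r * (1 + I)) -
      (1 - I) * (x : ℂ) ^ ((r : ℂ) * (1 - I)) / ((l : ℂ) - r * (1 - I))) (Ioi 0) ∧
    ∫ r in Ioi (0:ℝ), ((1 + I) * (x : ℂ) ^ ((r : ℂ) * (1 + I)) / ((l : ℂ) - r * (1 + I)) -
      (1 - I) * (x : ℂ) ^ ((r : ℂ) * (1 - I)) / ((l : ℂ) - r * (1 - I))) =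
      2 * Real.pi * I * ((x ^ l : ℝ) : ℂ) := by
  have hI1 : (1 + I : ℂ) ≠ 0 := by
    intro h; simpa using congrArg Complex.re h
  have hI2 : (1 - I : ℂ) ≠ 0 := by
    intro h; simpa using congrArg Complex.re h
  rcases hx0.eq_or_lt with rfl | hx
  · have h0 : EqOn (fun r : ℝ => (1 + I) * ((0:ℝ) : ℂ) ^ ((r : ℂ) * (1 + I)) /
        ((l : ℂ) - r * (1 + I)) - (1 - I) * ((0:ℝ) : ℂ) ^ ((r : ℂ) * (1 - I)) /
        ((l : ℂ) - r * (1 - I))) (fun _ => 0) (Ioi 0) := by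
      intro r hr
      have hr' : (r : ℂ) ≠ 0 := by exact_mod_cast (mem_Ioi.1 hr).ne'
      simp only [Complex.ofReal_zero]
      rw [Complex.zero_cpow (mul_ne_zero hr' hI1), Complex.zero_cpow (mul_ne_zero hr' hI2)]
      simp
    refine ⟨(integrableOn_congr_fun h0 measurableSet_Ioi).2 integrableOn_zero, ?_⟩
    rw [setIntegral_congr_fun measurableSet_Ioi h0, Real.zero_rpow hl.ne']
    simp
  · have hL : 0 < -Real.log x := neg_pos.2 (Real.log_neg hx hx1)
    have hxc : (x : ℂ) ≠ 0 := by exact_mod_cast hx.ne'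
    have h1 : ∀ r : ℝ, (1 + I) * (x : ℂ) ^ ((r : ℂ) * (1 + I)) / ((l : ℂ) - r * (1 + I)) =
        rayKernel l (-Real.log x) r := by
      intro r
      rw [rayKernel, Complex.cpow_def_of_ne_zero hxc, ← Complex.ofReal_log hx.le]
      congr 3
      push_cast; ring
    have h2 : ∀ r : ℝ, (1 - I) * (x : ℂ) ^ ((r : ℂ) * (1 - I)) / ((l : ℂ) - r * (1 - I)) =
        (starRingEnd ℂ) (rayKernel l (-Real.log x) r) := by
      intro r
      rw [rayKernel, Complex.cpow_def_of_ne_zero hxc, ← Complex.ofReal_log hx.le, map_div₀, map_mul,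
        ← Complex.exp_conj]
      simp only [map_mul, map_add, map_sub, map_neg, map_one, Complex.conj_I, Complex.conj_ofReal]
      rw [show (1 + -I : ℂ) = 1 - I by ring]
      congr 3
      push_cast; ring
    have hint := integrableOn_rayKernel hl hL
    have hint2 : IntegrableOn (fun r => (starRingEnd ℂ) (rayKernel l (-Real.log x) r)) (Ioi 0) := by
      exact (Complex.conjCLE : ℂ →L[ℝ] ℂ).integrable_comp hint
    simp only [h1, h2]
    refine ⟨hint.sub hint2, ?_⟩
    rw [integral_sub hint hint2, integral_conj, Complex.sub_conj, im_integral_rayKernel hl hL,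
      Real.rpow_def_of_pos hx]
    push_cast
    ring_nf

/-! ### Equicontinuity of Müntz polynomials on `[0, a]` -/

theorem norm_ofReal_cpow_diag {x r : ℝ} (hx : 0 ≤ x) (hr : 0 < r) :
    ‖(x : ℂ) ^ ((r : ℂ) * (1 + I))‖ = x ^ r ∧ ‖(x : ℂ) ^ ((r : ℂ) * (1 - I))‖ = x ^ r := by
  constructor
  · rw [Complex.norm_cpow_eq_rpow_re_of_nonneg hx (by simp [hr.ne']), diag_re]
  · rw [Complex.norm_cpow_eq_rpow_re_of_nonneg hx (by simp [hr.ne']), diag_conj_re]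

/-- The function whose weighted integral along the ray is a modulus of continuity for
the unit ball of a Müntz space. -/
noncomputable def rayDist (x y r : ℝ) : ℝ :=
  ‖(x : ℂ) ^ ((r : ℂ) * (1 + I)) - (y : ℂ) ^ ((r : ℂ) * (1 + I))‖ +
    ‖(x : ℂ) ^ ((r : ℂ) * (1 - I)) - (y : ℂ) ^ ((r : ℂ) * (1 - I))‖

theorem rayDist_nonneg (x y r : ℝ) : 0 ≤ rayDist x y r := by
  unfold rayDist; positivity

theorem measurable_rayDist (x y : ℝ) : Measurable (rayDist x y) := by
  unfold rayDist
  fun_prop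

theorem rayDist_le {a x y r : ℝ} (hx : x ∈ Icc 0 a) (hy : y ∈ Icc 0 a) (hr : 0 < r) :
    rayDist x y r ≤ 4 * a ^ r := by
  have h1 := Real.rpow_le_rpow hx.1 hx.2 hr.le
  have h2 := Real.rpow_le_rpow hy.1 hy.2 hr.le
  have h3 := norm_ofReal_cpow_diag hx.1 hr
  have h4 := norm_ofReal_cpow_diag hy.1 hr
  have h5 := norm_sub_le ((x : ℂ) ^ ((r : ℂ) * (1 + I))) ((y : ℂ) ^ ((r : ℂ) * (1 + I)))
  have h6 := norm_sub_le ((x : ℂ) ^ ((r : ℂ) * (1 - I))) ((y : ℂ) ^ ((r : ℂ) * (1 - I)))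
  rw [h3.1, h4.1] at h5
  rw [h3.2, h4.2] at h6
  unfold rayDist
  linarith

/-- Evaluations on `[0, a]` are bounded and equicontinuous on Müntz polynomials, with respect to
the `L¹` norm. -/
theorem exists_modulus {Λ : ℕ → ℝ} (hpos : ∀ n, 0 < Λ n) (hsum : Summable fun n => 1 / Λ n)
    {a : ℝ} (ha0 : 0 < a) (ha1 : a < 1) :
    ∃ ω : ℝ → ℝ → ℝ, (∃ B, ∀ x ∈ Icc 0 a, ∀ y ∈ Icc 0 a, 0 ≤ ω x y ∧ ω x y ≤ B) ∧
      (∀ x ∈ Icc 0 a, Tendsto (ω x) (𝓝[Icc 0 a] x) (𝓝 0)) ∧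
      ∀ (s : Finset ℕ) (c : ℕ → ℂ), ∀ x ∈ Icc 0 a, ∀ y ∈ Icc 0 a,
        ‖∑ n ∈ s, c n * ((x ^ Λ n : ℝ) : ℂ) - ∑ n ∈ s, c n * ((y ^ Λ n : ℝ) : ℂ)‖ ≤
          ω x y * ∫ t in (0:ℝ)..1, ‖∑ n ∈ s, c n * ((t ^ Λ n : ℝ) : ℂ)‖ := by
  -- Half of the decay rate of `a ^ r`: the growth `exp (ε r)` of the resolvent sum still leaves
  -- `exp (-ε r)` for domination.
  set ε := -Real.log a / 2 with hε
  have hε0 : 0 < ε := by have := Real.log_neg ha0 ha1; linarith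
  obtain ⟨C, hC0, hC⟩ := exists_prod_one_add_le_mul_exp hpos hsum hε0
  have hexp : ∀ r : ℝ, Real.exp (ε * r) * a ^ r = Real.exp (-ε * r) := by
    intro r
    rw [Real.rpow_def_of_pos ha0, ← Real.exp_add, hε]
    ring_nf
  have hbint : IntegrableOn (fun r => 4 * Real.exp (-ε * r)) (Ioi 0) :=
    (exp_neg_integrableOn_Ioi 0 hε0).const_mul _
  have hbd : ∀ x ∈ Icc 0 a, ∀ y ∈ Icc 0 a, ∀ r : ℝ, 0 < r →
      Real.exp (ε * r) * rayDist x y r ≤ 4 * Real.exp (-ε * r) := by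
    intro x hx y hy r hr
    calc Real.exp (ε * r) * rayDist x y r ≤ Real.exp (ε * r) * (4 * a ^ r) := by
          gcongr; exact rayDist_le hx hy hr
      _ = 4 * (Real.exp (ε * r) * a ^ r) := by ring
      _ = _ := by rw [hexp]
  have hmeas : ∀ x y, Measurable fun r => Real.exp (ε * r) * rayDist x y r := fun x y =>
    Measurable.mul (by fun_prop) (measurable_rayDist x y)
  have hnn : ∀ x y r, 0 ≤ Real.exp (ε * r) * rayDist x y r := fun x y r =>
    mul_nonneg (Real.exp_pos _).le (rayDist_nonneg x y r)
  have hint : ∀ x ∈ Icc 0 a, ∀ y ∈ Icc 0 a,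
      IntegrableOn (fun r => Real.exp (ε * r) * rayDist x y r) (Ioi 0) := by
    intro x hx y hy
    refine Integrable.mono' hbint (hmeas x y).aestronglyMeasurable ?_
    filter_upwards [ae_restrict_mem measurableSet_Ioi] with r hr
    rw [Real.norm_of_nonneg (hnn x y r)]
    exact hbd x hx y hy r hr
  refine ⟨fun x y => C * ∫ r in Ioi 0, Real.exp (ε * r) * rayDist x y r,
    ⟨C * ∫ r in Ioi 0, 4 * Real.exp (-ε * r), fun x hx y hy => ⟨?_, ?_⟩⟩, fun x hx => ?_,
    fun s c x hx y hy => ?_⟩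
  · exact mul_nonneg hC0.le (integral_nonneg fun r => hnn x y r)
  · refine mul_le_mul_of_nonneg_left ?_ hC0.le
    exact setIntegral_mono_on (hint x hx y hy) hbint measurableSet_Ioi
      fun r hr => hbd x hx y hy r hr
  · have h : Tendsto (fun y => ∫ r in Ioi 0, Real.exp (ε * r) * rayDist x y r) (𝓝[Icc 0 a] x)
        (𝓝 (∫ r in Ioi (0:ℝ), (0:ℝ))) := by
      refine tendsto_integral_filter_of_dominated_convergence
        (fun r => 4 * Real.exp (-ε * r)) ?_ ?_ hbint ?_
      · exact Eventually.of_forall fun y => (hmeas x y).aestronglyMeasurable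
      · filter_upwards [self_mem_nhdsWithin] with y hy
        filter_upwards [ae_restrict_mem measurableSet_Ioi] with r hr
        rw [Real.norm_of_nonneg (hnn x y r)]
        exact hbd x hx y hy r hr
      · filter_upwards [ae_restrict_mem measurableSet_Ioi] with r hr
        have hr' : 0 < r := hr
        refine Tendsto.mono_left ?_ nhdsWithin_le_nhds
        have c1 : ContinuousAt (fun y : ℝ => (y : ℂ) ^ ((r : ℂ) * (1 + I))) x :=
          Complex.continuousAt_ofReal_cpow_const _ _ (Or.inl (by simpa using hr'))
        have c2 : ContinuousAt (fun y : ℝ => (y : ℂ) ^ ((r : ℂ) * (1 - I))) x :=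
          Complex.continuousAt_ofReal_cpow_const _ _ (Or.inl (by simpa using hr'))
        have c3 : ContinuousAt (fun y => Real.exp (ε * r) * rayDist x y r) x := by
          unfold rayDist
          exact continuousAt_const.mul
            ((continuousAt_const.sub c1).norm.add (continuousAt_const.sub c2).norm)
        have := c3.tendsto
        simpa [rayDist] using this
    simpa using h.const_mul C
  · set A := ∫ t in (0:ℝ)..1, ‖∑ n ∈ s, c n * ((t ^ Λ n : ℝ) : ℂ)‖ with hA
    have hA0 : 0 ≤ A := intervalIntegral.integral_nonneg zero_le_one fun _ _ => norm_nonneg _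
    set R : ℂ → ℂ := fun q => ∑ n ∈ s, c n / ((Λ n : ℂ) - q) with hR
    have hRb : ∀ q : ℂ, ∀ r : ℝ, q.re = r → |q.im| = r → ‖R q‖ ≤ A * (C * Real.exp (ε * r)) := by
      intro q r hre him
      refine (norm_sum_div_sub_le_of_diag hpos s c hre him).trans ?_
      exact mul_le_mul_of_nonneg_left (hC s r (him ▸ abs_nonneg _)) hA0
    -- Linearity of `integral_cpow_ray`: the coefficients enter only through `R`, which is
    -- controlled by the `L¹` norm alone.
    have hrep : ∀ x ∈ Icc 0 a, IntegrableOn (fun r : ℝ =>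
        (1 + I) * R (r * (1 + I)) * (x : ℂ) ^ ((r : ℂ) * (1 + I)) -
        (1 - I) * R (r * (1 - I)) * (x : ℂ) ^ ((r : ℂ) * (1 - I))) (Ioi 0) ∧
        2 * Real.pi * I * ∑ n ∈ s, c n * ((x ^ Λ n : ℝ) : ℂ) = ∫ r in Ioi (0:ℝ),
        ((1 + I) * R (r * (1 + I)) * (x : ℂ) ^ ((r : ℂ) * (1 + I)) -
        (1 - I) * R (r * (1 - I)) * (x : ℂ) ^ ((r : ℂ) * (1 - I))) := by
      intro x hx
      have hx1 : x < 1 := hx.2.trans_lt ha1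
      have e : (fun r : ℝ => (1 + I) * R (r * (1 + I)) * (x : ℂ) ^ ((r : ℂ) * (1 + I)) -
        (1 - I) * R (r * (1 - I)) * (x : ℂ) ^ ((r : ℂ) * (1 - I))) = fun r : ℝ => ∑ n ∈ s, c n *
        ((1 + I) * (x : ℂ) ^ ((r : ℂ) * (1 + I)) / ((Λ n : ℂ) - r * (1 + I)) -
          (1 - I) * (x : ℂ) ^ ((r : ℂ) * (1 - I)) / ((Λ n : ℂ) - r * (1 - I))) := by
        funext r
        simp only [hR, Finset.mul_sum, Finset.sum_mul, ← Finset.sum_sub_distrib]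
        refine Finset.sum_congr rfl fun n _ => ?_
        ring
      have hi : ∀ n ∈ s, IntegrableOn (fun r : ℝ => c n *
        ((1 + I) * (x : ℂ) ^ ((r : ℂ) * (1 + I)) / ((Λ n : ℂ) - r * (1 + I)) -
          (1 - I) * (x : ℂ) ^ ((r : ℂ) * (1 - I)) / ((Λ n : ℂ) - r * (1 - I)))) (Ioi 0) :=
        fun n _ => (integral_cpow_ray (hpos n) hx.1 hx1).1.const_mul _
      rw [e]
      refine ⟨integrable_finsetSum s hi, ?_⟩
      rw [integral_finsetSum s hi, Finset.mul_sum]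
      refine Finset.sum_congr rfl fun n _ => ?_
      rw [integral_const_mul, (integral_cpow_ray (hpos n) hx.1 hx1).2]
      ring
    have hxy : 2 * Real.pi * I * (∑ n ∈ s, c n * ((x ^ Λ n : ℝ) : ℂ) -
        ∑ n ∈ s, c n * ((y ^ Λ n : ℝ) : ℂ)) = ∫ r in Ioi (0:ℝ),
        (((1 + I) * R (r * (1 + I)) * (x : ℂ) ^ ((r : ℂ) * (1 + I)) -
        (1 - I) * R (r * (1 - I)) * (x : ℂ) ^ ((r : ℂ) * (1 - I))) -
        ((1 + I) * R (r * (1 + I)) * (y : ℂ) ^ ((r : ℂ) * (1 + I)) -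
        (1 - I) * R (r * (1 - I)) * (y : ℂ) ^ ((r : ℂ) * (1 - I)))) := by
      rw [integral_sub (hrep x hx).1 (hrep y hy).1, mul_sub, (hrep x hx).2, (hrep y hy).2]
    have hnorm : 2 * Real.pi * ‖∑ n ∈ s, c n * ((x ^ Λ n : ℝ) : ℂ) -
        ∑ n ∈ s, c n * ((y ^ Λ n : ℝ) : ℂ)‖ ≤ ∫ r in Ioi (0:ℝ),
        2 * A * C * (Real.exp (ε * r) * rayDist x y r) := by
      have h1 := congrArg norm hxy
      rw [norm_mul, norm_mul, norm_mul, Complex.norm_I, Complex.norm_real,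
        Real.norm_of_nonneg Real.pi_pos.le, Complex.norm_two, mul_one] at h1
      rw [h1]
      refine norm_integral_le_of_norm_le ((hint x hx y hy).const_mul _) ?_
      filter_upwards [ae_restrict_mem measurableSet_Ioi] with r hr
      have hr' : 0 < r := hr
      have b1 := hRb _ r (diag_re r) (abs_diag_im hr'.le)
      have b2 := hRb _ r (diag_conj_re r) (abs_diag_conj_im hr'.le)
      have e : ((1 + I) * R (r * (1 + I)) * (x : ℂ) ^ ((r : ℂ) * (1 + I)) -
        (1 - I) * R (r * (1 - I)) * (x : ℂ) ^ ((r : ℂ) * (1 - I))) -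
        ((1 + I) * R (r * (1 + I)) * (y : ℂ) ^ ((r : ℂ) * (1 + I)) -
        (1 - I) * R (r * (1 - I)) * (y : ℂ) ^ ((r : ℂ) * (1 - I))) =
        (1 + I) * R (r * (1 + I)) * ((x : ℂ) ^ ((r : ℂ) * (1 + I)) - (y : ℂ) ^ ((r : ℂ) * (1 + I))) -
        (1 - I) * R (r * (1 - I)) * ((x : ℂ) ^ ((r : ℂ) * (1 - I)) - (y : ℂ) ^ ((r : ℂ) * (1 - I))) := by
        ring
      rw [e]
      refine (norm_sub_le _ _).trans ?_
      rw [norm_mul, norm_mul, norm_mul, norm_mul, rayDist]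
      calc _ ≤ 2 * (A * (C * Real.exp (ε * r))) *
              ‖(x : ℂ) ^ ((r : ℂ) * (1 + I)) - (y : ℂ) ^ ((r : ℂ) * (1 + I))‖ +
            2 * (A * (C * Real.exp (ε * r))) *
              ‖(x : ℂ) ^ ((r : ℂ) * (1 - I)) - (y : ℂ) ^ ((r : ℂ) * (1 - I))‖ := by
            gcongr
            · exact norm_one_add_I_le
            · exact norm_one_sub_I_le
        _ = _ := by ring
    rw [integral_const_mul] at hnorm
    have hpi : 1 ≤ Real.pi := by linarith [Real.pi_gt_three]
    have h0 := norm_nonneg (∑ n ∈ s, c n * ((x ^ Λ n : ℝ) : ℂ) -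
        ∑ n ∈ s, c n * ((y ^ Λ n : ℝ) : ℂ))
    nlinarith

/-! ### Continuous representatives of elements of the Müntz space -/

/-- The generalized polynomial with exponents `Λ` and coefficients `c`. -/
noncomputable def muntzPoly (Λ : ℕ → ℝ) (c : ℕ →₀ ℂ) (x : ℝ) : ℂ :=
  c.sum fun n a => a * ((x ^ Λ n : ℝ) : ℂ)

theorem muntzPoly_add (Λ : ℕ → ℝ) (c d : ℕ →₀ ℂ) (x : ℝ) :
    muntzPoly Λ (c + d) x = muntzPoly Λ c x + muntzPoly Λ d x :=
  Finsupp.sum_add_index' (by simp) (by intros; ring)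

theorem muntzPoly_smul (Λ : ℕ → ℝ) (b : ℂ) (c : ℕ →₀ ℂ) (x : ℝ) :
    muntzPoly Λ (b • c) x = b * muntzPoly Λ c x := by
  rw [muntzPoly, Finsupp.sum_smul_index (by simp), muntzPoly, Finsupp.mul_sum]
  simp [mul_assoc]

theorem muntzPoly_sub (Λ : ℕ → ℝ) (c d : ℕ →₀ ℂ) (x : ℝ) :
    muntzPoly Λ (c - d) x = muntzPoly Λ c x - muntzPoly Λ d x := by
  have : c - d = c + (-1 : ℂ) • d := by simp [sub_eq_add_neg]
  rw [this, muntzPoly_add, muntzPoly_smul]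
  ring

theorem muntzPoly_zero_right {Λ : ℕ → ℝ} (hpos : ∀ n, 0 < Λ n) (c : ℕ →₀ ℂ) :
    muntzPoly Λ c 0 = 0 := by
  simp [muntzPoly, Finsupp.sum, Real.zero_rpow (hpos _).ne']

theorem ae_unitMeasure_mem_Ico : ∀ᵐ x ∂unitMeasure, x ∈ Ico (0 : ℝ) 1 := by
  have h1 : ∀ᵐ x ∂unitMeasure, x ≠ 1 :=
    ae_restrict_of_ae (Measure.ae_ne volume 1)
  filter_upwards [h1, ae_restrict_mem measurableSet_Icc] with x hx hx'
  exact ⟨hx'.1, lt_of_le_of_ne hx'.2 hx⟩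

theorem eqOn_Ico_of_ae_eq {g h : ℝ → ℂ} (hg : ContinuousOn g (Ico 0 1))
    (hh : ContinuousOn h (Ico 0 1)) (hgh : g =ᵐ[unitMeasure] h) : EqOn g h (Ico 0 1) := by
  refine Measure.eqOn_of_ae_eq (μ := volume) ?_ hg hh ?_
  · exact ae_restrict_of_ae_restrict_of_subset Ico_subset_Icc_self hgh
  · rw [interior_Ico, closure_Ioo zero_ne_one]
    exact Ico_subset_Icc_self

theorem exists_muntzPoly_of_mem_span {Λ : ℕ → ℝ} {f : L1Unit}
    (hf : f ∈ Submodule.span ℂ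
      {f : L1Unit | ∃ n : ℕ, f =ᵐ[unitMeasure] fun x : ℝ => ((x ^ Λ n : ℝ) : ℂ)}) :
    ∃ c : ℕ →₀ ℂ, f =ᵐ[unitMeasure] muntzPoly Λ c := by
  induction hf using Submodule.span_induction with
  | mem f hf =>
    obtain ⟨n, hn⟩ := hf
    refine ⟨Finsupp.single n 1, hn.trans (Eventually.of_forall fun x => ?_)⟩
    simp [muntzPoly]
  | zero =>
    refine ⟨0, (Lp.coeFn_zero _ _ _).trans (Eventually.of_forall fun x => ?_)⟩
    simp [muntzPoly]
  | add f g _ _ hf hg =>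
    obtain ⟨c, hc⟩ := hf
    obtain ⟨d, hd⟩ := hg
    refine ⟨c + d, ?_⟩
    filter_upwards [Lp.coeFn_add f g, hc, hd] with x h1 h2 h3
    rw [h1, Pi.add_apply, h2, h3, muntzPoly_add]
  | smul b f _ hf =>
    obtain ⟨c, hc⟩ := hf
    refine ⟨b • c, ?_⟩
    filter_upwards [Lp.coeFn_smul b f, hc] with x h1 h2
    rw [h1, Pi.smul_apply, h2, muntzPoly_smul, smul_eq_mul]

theorem norm_eq_intervalIntegral_of_ae_eq {f : L1Unit} {p : ℝ → ℂ} (h : f =ᵐ[unitMeasure] p) :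
    ‖f‖ = ∫ t in (0:ℝ)..1, ‖p t‖ := by
  rw [L1.norm_eq_integral_norm, intervalIntegral.integral_of_le zero_le_one,
    ← integral_Icc_eq_integral_Ioc]
  exact integral_congr_ae (h.mono fun x hx => by simp [hx])

/-- A modulus for the unit ball of the Müntz space on `[0, a]`. -/
structure IsMuntzModulus (a : ℝ) (ω : ℝ → ℝ → ℝ) : Prop where
  bdd : ∃ B, ∀ x ∈ Icc 0 a, ∀ y ∈ Icc 0 a, 0 ≤ ω x y ∧ ω x y ≤ B
  tendsto : ∀ x ∈ Icc 0 a, Tendsto (ω x) (𝓝[Icc 0 a] x) (𝓝 0)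

/-- Müntz polynomials vanish at `0`, so the modulus with `y = 0` bounds point evaluations by the
`L¹` norm. Approximating polynomials therefore converge pointwise on `[0, 1)`, and the moduli pass
to the limit. -/
theorem exists_rep {Λ : ℕ → ℝ} (hpos : ∀ n, 0 < Λ n) (hsum : Summable fun n => 1 / Λ n) :
    ∃ ω : ℝ → ℝ → ℝ → ℝ, (∀ a ∈ Ioo (0:ℝ) 1, IsMuntzModulus a (ω a)) ∧
      ∀ f ∈ muntzSpace Λ, ∃ g : ℝ → ℂ, ContinuousOn g (Ico 0 1) ∧ f =ᵐ[unitMeasure] g ∧ g 0 = 0 ∧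
        ∀ a ∈ Ioo (0:ℝ) 1, ∀ x ∈ Icc 0 a, ∀ y ∈ Icc 0 a, ‖g x - g y‖ ≤ ω a x y * ‖f‖ := by
  have h0 : ∀ a : ℝ, ∃ ω : ℝ → ℝ → ℝ, a ∈ Ioo (0:ℝ) 1 → (IsMuntzModulus a ω ∧
      ∀ (c : ℕ →₀ ℂ), ∀ x ∈ Icc 0 a, ∀ y ∈ Icc 0 a, ‖muntzPoly Λ c x - muntzPoly Λ c y‖ ≤
          ω x y * ∫ t in (0:ℝ)..1, ‖muntzPoly Λ c t‖) := by
    intro a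
    by_cases ha : a ∈ Ioo (0:ℝ) 1
    · obtain ⟨ω, h1, h2, h3⟩ := exists_modulus hpos hsum ha.1 ha.2
      exact ⟨ω, fun _ => ⟨⟨h1, h2⟩, fun c => h3 c.support c⟩⟩
    · exact ⟨0, fun h => absurd h ha⟩
  choose ω hω using h0
  refine ⟨ω, fun a ha => (hω a ha).1, fun f hf => ?_⟩
  obtain ⟨F, hF, hlim⟩ := mem_closure_iff_seq_limit.1 hf
  choose c hc using fun k => exists_muntzPoly_of_mem_span (hF k)
  have hbound : ∀ k l : ℕ, ∀ a ∈ Ioo (0:ℝ) 1, ∀ x ∈ Icc 0 a,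
      ‖muntzPoly Λ (c k) x - muntzPoly Λ (c l) x‖ ≤ ω a x 0 * ‖F k - F l‖ := by
    intro k l a ha x hx
    have h := (hω a ha).2 (c k - c l) x hx 0 ⟨le_rfl, ha.1.le⟩
    rw [muntzPoly_zero_right hpos, sub_zero, muntzPoly_sub] at h
    rwa [norm_eq_intervalIntegral_of_ae_eq (f := F k - F l) (p := muntzPoly Λ (c k - c l))]
    filter_upwards [Lp.coeFn_sub (F k) (F l), hc k, hc l] with x h1 h2 h3
    rw [h1, Pi.sub_apply, h2, h3, muntzPoly_sub]
  have hmid : ∀ x ∈ Ico (0:ℝ) 1, (x + 1) / 2 ∈ Ioo (0:ℝ) 1 ∧ x ∈ Icc 0 ((x + 1) / 2) := by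
    rintro x ⟨h0, h1⟩
    exact ⟨⟨by linarith, by linarith⟩, h0, by linarith⟩
  have hconv : ∀ x : ℝ, ∃ y : ℂ, x ∈ Ico (0:ℝ) 1 →
      Tendsto (fun k => muntzPoly Λ (c k) x) atTop (𝓝 y) := by
    intro x
    by_cases hx : x ∈ Ico (0:ℝ) 1
    · obtain ⟨ha, hxa⟩ := hmid x hx
      have hcs : CauchySeq fun k => muntzPoly Λ (c k) x := by
        have hF' := hlim.cauchySeq
        obtain ⟨b, hb0, hb, hb1⟩ := cauchySeq_iff_le_tendsto_0.1 hF'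
        refine cauchySeq_of_le_tendsto_0 (fun N => ω ((x + 1) / 2) x 0 * b N) ?_ ?_
        · intro k l N hk hl
          rw [dist_eq_norm]
          refine (hbound k l _ ha x hxa).trans ?_
          refine mul_le_mul_of_nonneg_left ?_ ?_
          · rw [← dist_eq_norm]; exact hb k l N hk hl
          · obtain ⟨B, hB⟩ := (hω _ ha).1.bdd
            exact (hB x hxa 0 ⟨le_rfl, ha.1.le⟩).1
        · simpa using hb1.const_mul (ω ((x + 1) / 2) x 0)
      obtain ⟨y, hy⟩ := cauchySeq_tendsto_of_complete hcs
      exact ⟨y, fun _ => hy⟩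
    · exact ⟨0, fun h => absurd h hx⟩
  choose g hg using hconv
  have hsubIco : ∀ a ∈ Ioo (0:ℝ) 1, Icc 0 a ⊆ Ico 0 1 := fun a ha x hx =>
    ⟨hx.1, hx.2.trans_lt ha.2⟩
  have hgω : ∀ a ∈ Ioo (0:ℝ) 1, ∀ x ∈ Icc 0 a, ∀ y ∈ Icc 0 a, ‖g x - g y‖ ≤ ω a x y * ‖f‖ := by
    intro a ha x hx y hy
    refine le_of_tendsto_of_tendsto
      ((hg x (hsubIco a ha hx)).sub (hg y (hsubIco a ha hy))).norm
      (hlim.norm.const_mul (ω a x y)) (Eventually.of_forall fun k => ?_)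
    have := (hω a ha).2 (c k) x hx y hy
    rwa [← norm_eq_intervalIntegral_of_ae_eq (hc k)] at this
  refine ⟨g, ?_, ?_, ?_, hgω⟩
  · intro x hx
    obtain ⟨ha, hxa⟩ := hmid x hx
    have h1 : ContinuousWithinAt g (Icc 0 ((x + 1) / 2)) x := by
      rw [ContinuousWithinAt, tendsto_iff_norm_sub_tendsto_zero]
      have h2 := ((hω _ ha).1.tendsto x hxa).mul_const ‖f‖
      rw [zero_mul] at h2
      refine squeeze_zero' (Eventually.of_forall fun _ => norm_nonneg _) ?_ h2
      filter_upwards [self_mem_nhdsWithin] with y hy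
      rw [norm_sub_rev]
      exact hgω _ ha x hxa y hy
    refine h1.mono_of_mem_nhdsWithin ?_
    have h3 : Iio ((x + 1) / 2) ∈ 𝓝 x := Iio_mem_nhds (by linarith [hx.2])
    filter_upwards [self_mem_nhdsWithin, mem_nhdsWithin_of_mem_nhds h3] with y hy hy'
    exact ⟨hy.1, le_of_lt hy'⟩
  -- `L¹` convergence gives an a.e. convergent subsequence, which identifies the pointwise limit
  -- with `f`.
  · obtain ⟨ns, hns, hae⟩ := (tendstoInMeasure_of_tendsto_Lp hlim).exists_seq_tendsto_ae
    filter_upwards [hae, ae_all_iff.2 hc, ae_unitMeasure_mem_Ico] with x h1 h2 h3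
    have h4 := (hg x h3).comp hns.tendsto_atTop
    refine tendsto_nhds_unique h1 (h4.congr fun k => ?_)
    exact (h2 (ns k)).symm
  · have h1 := hg 0 ⟨le_rfl, zero_lt_one⟩
    simp only [muntzPoly_zero_right hpos] at h1
    exact tendsto_nhds_unique h1 tendsto_const_nhds

/-! ### Push-forward of the weighted Lebesgue measure near the fibre -/

/-- Two-sided comparison, up to `η`, of the weighted push-forward under `φ` of Lebesgue measure
on `J` with `k` times Lebesgue measure: from above on `[0, 1]`, from below near `1`. -/
structure PushforwardEstimate (φ v : ℝ → ℝ) (J : Set ℝ) (k η : ℝ) : Prop where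
  upper : ∀ h : ℝ → ENNReal, ∫⁻ y in J, ENNReal.ofReal (v y) * h (φ y) ≤
    ENNReal.ofReal (k + η) * ∫⁻ u in Icc 0 1, h u
  lower : ∃ b ∈ Ico (0:ℝ) 1, ∀ h : ℝ → ENNReal, ENNReal.ofReal (k - η) * ∫⁻ u in Ioo b 1, h u ≤
    ∫⁻ y in J, ENNReal.ofReal (v y) * h (φ y)

namespace PushforwardEstimate

theorem empty (φ v : ℝ → ℝ) {η : ℝ} (hη : 0 ≤ η) : PushforwardEstimate φ v ∅ 0 η := by
  refine ⟨fun h => by simp, 0, by simp, fun h => ?_⟩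
  rw [ENNReal.ofReal_of_nonpos (by linarith)]
  simp

theorem union {φ v : ℝ → ℝ} {J₁ J₂ : Set ℝ} {k₁ k₂ η₁ η₂ : ℝ} (hd : Disjoint J₁ J₂)
    (hm : MeasurableSet J₂) (hk₁ : 0 ≤ k₁ + η₁) (hk₂ : 0 ≤ k₂ + η₂)
    (h₁ : PushforwardEstimate φ v J₁ k₁ η₁) (h₂ : PushforwardEstimate φ v J₂ k₂ η₂) :
    PushforwardEstimate φ v (J₁ ∪ J₂) (k₁ + k₂) (η₁ + η₂) := by
  obtain ⟨b₁, hb₁, hl₁⟩ := h₁.lower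
  obtain ⟨b₂, hb₂, hl₂⟩ := h₂.lower
  refine ⟨fun h => ?_, max b₁ b₂, ⟨le_max_of_le_left hb₁.1, max_lt hb₁.2 hb₂.2⟩, fun h => ?_⟩
  · rw [lintegral_union hm hd, show k₁ + k₂ + (η₁ + η₂) = (k₁ + η₁) + (k₂ + η₂) by ring,
      ENNReal.ofReal_add hk₁ hk₂, add_mul]
    exact add_le_add (h₁.upper h) (h₂.upper h)
  · rw [lintegral_union hm hd, show k₁ + k₂ - (η₁ + η₂) = (k₁ - η₁) + (k₂ - η₂) by ring]
    -- Only subadditivity is available: `k - η` may be negative, where `ENNReal.ofReal` truncates it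
    -- to `0`.
    refine (mul_le_mul_left ENNReal.ofReal_add_le _).trans ?_
    rw [add_mul]
    refine add_le_add (le_trans ?_ (hl₁ h)) (le_trans ?_ (hl₂ h))
    · exact mul_le_mul_right (lintegral_mono_set (Ioo_subset_Ioo_left (le_max_left _ _))) _
    · exact mul_le_mul_right (lintegral_mono_set (Ioo_subset_Ioo_left (le_max_right _ _))) _

theorem congr_set {φ v : ℝ → ℝ} {J₁ J₂ : Set ℝ} {k η : ℝ} (hJ : J₁ =ᵐ[volume] J₂)
    (h : PushforwardEstimate φ v J₁ k η) : PushforwardEstimate φ v J₂ k η := by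
  have e := Measure.restrict_congr_set hJ
  exact ⟨fun f => e ▸ h.upper f, e ▸ h.lower⟩

theorem biUnion {ι : Type*} [DecidableEq ι] {φ v : ℝ → ℝ} (s : Finset ι) (J : ι → Set ℝ)
    (k : ι → ℝ) {η : ℝ} (hη : 0 ≤ η) (hk : ∀ i ∈ s, 0 ≤ k i)
    (hd : ∀ i ∈ s, ∀ j ∈ s, i ≠ j → Disjoint (J i) (J j)) (hm : ∀ i ∈ s, MeasurableSet (J i))
    (h : ∀ i ∈ s, PushforwardEstimate φ v (J i) (k i) η) :
    PushforwardEstimate φ v (⋃ i ∈ s, J i) (∑ i ∈ s, k i) (s.card * η) := by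
  induction s using Finset.induction_on with
  | empty => simpa using empty φ v le_rfl
  | insert a s ha ih =>
    have ih' := ih (fun i hi => hk i (Finset.mem_insert_of_mem hi))
      (fun i hi j hj => hd i (Finset.mem_insert_of_mem hi) j (Finset.mem_insert_of_mem hj))
      (fun i hi => hm i (Finset.mem_insert_of_mem hi))
      (fun i hi => h i (Finset.mem_insert_of_mem hi))
    rw [Finset.set_biUnion_insert, Finset.sum_insert ha, Finset.card_insert_of_notMem ha]
    have : ((s.card + 1 : ℕ) : ℝ) * η = η + s.card * η := by push_cast; ring
    rw [this]
    have ha' := Finset.mem_insert_self a s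
    refine union ?_ ?_ ?_ ?_ (h a ha') ih'
    · rw [disjoint_iUnion₂_right]
      intro i hi
      exact hd a ha' i (Finset.mem_insert_of_mem hi) (by rintro rfl; exact ha hi)
    · exact Finset.measurableSet_biUnion s fun i hi => hm i (Finset.mem_insert_of_mem hi)
    · exact add_nonneg (hk a ha') hη
    · exact add_nonneg (Finset.sum_nonneg fun i hi => hk i (Finset.mem_insert_of_mem hi))
        (by positivity)

end PushforwardEstimate

/-- Near `0` the function `χ` is strictly decreasing, and the substitution `u = χ t` produces the
density `v / |χ'|`, which tends to `v 0 / m` because `χ` is `C¹` up to the endpoint. The image of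
`(0, δ)` lies in `[0, 1]` and contains `(χ δ, 1)`. -/
theorem eventually_pushforwardEstimate_Ioo {χ v : ℝ → ℝ} {θ m : ℝ} (hθ : 0 < θ)
    (hχ : ContDiffOn ℝ 1 χ (Icc 0 θ)) (hmaps : MapsTo χ (Icc 0 θ) (Icc 0 1)) (hχ0 : χ 0 = 1)
    (hm : 0 < m) (hd : HasDerivWithinAt χ (-m) (Icc 0 θ) 0)
    (hv : ContinuousWithinAt v (Icc 0 θ) 0) {η : ℝ} (hη : 0 < η) :
    ∀ᶠ δ in 𝓝[>] (0:ℝ), PushforwardEstimate χ v (Ioo 0 δ) (v 0 / m) η := by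
  set d : ℝ → ℝ := derivWithin χ (Icc 0 θ) with hdd
  have hu : UniqueDiffOn ℝ (Icc 0 θ) := uniqueDiffOn_Icc hθ
  have h0 : (0:ℝ) ∈ Icc 0 θ := ⟨le_rfl, hθ.le⟩
  have hd0 : d 0 = -m := hd.derivWithin (hu 0 h0)
  have hdc : ContinuousWithinAt d (Icc 0 θ) 0 :=
    hχ.continuousOn_derivWithin hu le_rfl 0 h0
  have hlt : ∀ᶠ t in 𝓝[Icc 0 θ] (0:ℝ), d t < 0 :=
    hdc.eventually_lt continuousWithinAt_const (by rw [hd0]; linarith)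
  have hq : Tendsto (fun t => v t / |d t|) (𝓝[Icc 0 θ] 0) (𝓝 (v 0 / m)) := by
    have := hv.tendsto.div hdc.abs.tendsto (by rw [hd0]; simpa using hm.ne')
    rwa [hd0, abs_neg, abs_of_pos hm] at this
  have hall : ∀ᶠ t in 𝓝[Icc 0 θ] (0:ℝ), d t < 0 ∧ v 0 / m - η < v t / |d t| ∧
      v t / |d t| < v 0 / m + η :=
    hlt.and ((hq.eventually (lt_mem_nhds (by linarith))).and
      (hq.eventually (gt_mem_nhds (by linarith))))
  rw [eventually_nhdsWithin_iff, Metric.eventually_nhds_iff] at hall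
  obtain ⟨r, hr, hall⟩ := hall
  have hmem : Ioo 0 (min r θ) ∈ 𝓝[>] (0:ℝ) := Ioo_mem_nhdsGT (by positivity)
  filter_upwards [hmem] with δ hδ
  have hδ0 : 0 < δ := hδ.1
  have hδr : δ < r := hδ.2.trans_le (min_le_left _ _)
  have hδθ : δ < θ := hδ.2.trans_le (min_le_right _ _)
  have hsub : Icc 0 δ ⊆ Icc 0 θ := Icc_subset_Icc_right hδθ.le
  have hpt : ∀ t ∈ Ioo 0 δ, d t < 0 ∧ v 0 / m - η < v t / |d t| ∧ v t / |d t| < v 0 / m + η := by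
    intro t ht
    refine hall ?_ (hsub (Ioo_subset_Icc_self ht))
    rw [dist_zero_right, Real.norm_of_nonneg ht.1.le]
    exact ht.2.trans hδr
  have hder : ∀ t ∈ Ioo 0 δ, HasDerivAt χ (d t) t := by
    intro t ht
    have h1 := (hχ.differentiableOn one_ne_zero t (hsub (Ioo_subset_Icc_self ht))).hasDerivWithinAt
    exact h1.hasDerivAt (Icc_mem_nhds ht.1 (ht.2.trans hδθ))
  have hanti : StrictAntiOn χ (Icc 0 δ) := by
    refine strictAntiOn_of_deriv_neg (convex_Icc _ _) (hχ.continuousOn.mono hsub) fun t ht => ?_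
    rw [interior_Icc] at ht
    rw [(hder t ht).deriv]
    exact (hpt t ht).1
  have hinj : InjOn χ (Ioo 0 δ) := hanti.injOn.mono Ioo_subset_Icc_self
  have hcv := fun h : ℝ → ENNReal => lintegral_image_eq_lintegral_abs_deriv_mul measurableSet_Ioo
    (fun t ht => (hder t ht).hasDerivWithinAt) hinj h
  have hfac : ∀ t ∈ Ioo 0 δ, ENNReal.ofReal (v t) =
      ENNReal.ofReal (v t / |d t|) * ENNReal.ofReal |d t| := by
    intro t ht
    rw [← ENNReal.ofReal_mul' (abs_nonneg _), div_mul_cancel₀]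
    exact abs_ne_zero.2 (hpt t ht).1.ne
  refine ⟨fun h => ?_, χ δ, ⟨(hmaps (hsub ⟨hδ0.le, le_rfl⟩)).1, ?_⟩, fun h => ?_⟩
  · calc ∫⁻ t in Ioo 0 δ, ENNReal.ofReal (v t) * h (χ t)
        ≤ ∫⁻ t in Ioo 0 δ, ENNReal.ofReal (v 0 / m + η) * (ENNReal.ofReal |d t| * h (χ t)) := by
          refine setLIntegral_mono' measurableSet_Ioo fun t ht => ?_
          rw [hfac t ht, mul_assoc]
          exact mul_le_mul_left (ENNReal.ofReal_le_ofReal (hpt t ht).2.2.le) _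
      _ = ENNReal.ofReal (v 0 / m + η) * ∫⁻ u in χ '' Ioo 0 δ, h u := by
          rw [lintegral_const_mul' _ _ ENNReal.ofReal_ne_top, hcv]
      _ ≤ _ := by
          refine mul_le_mul_right (lintegral_mono_set ?_) _
          exact (image_mono (Ioo_subset_Icc_self.trans hsub)).trans hmaps.image_subset
  · rw [← hχ0]
    exact hanti ⟨le_rfl, hδ0.le⟩ ⟨hδ0.le, le_rfl⟩ hδ0
  · calc ENNReal.ofReal (v 0 / m - η) * ∫⁻ u in Ioo (χ δ) 1, h u
        ≤ ENNReal.ofReal (v 0 / m - η) * ∫⁻ u in χ '' Ioo 0 δ, h u := by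
          refine mul_le_mul_right (lintegral_mono_set ?_) _
          rw [← hχ0]
          exact intermediate_value_Ioo' hδ0.le (hχ.continuousOn.mono hsub)
      _ = ∫⁻ t in Ioo 0 δ, ENNReal.ofReal (v 0 / m - η) * (ENNReal.ofReal |d t| * h (χ t)) := by
          rw [lintegral_const_mul' _ _ ENNReal.ofReal_ne_top, hcv]
      _ ≤ _ := by
          refine setLIntegral_mono' measurableSet_Ioo fun t ht => ?_
          rw [hfac t ht, mul_assoc]
          exact mul_le_mul_left (ENNReal.ofReal_le_ofReal (hpt t ht).2.1.le) _

theorem PushforwardEstimate.comp_add {φ v : ℝ → ℝ} {x δ k η : ℝ}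
    (h : PushforwardEstimate (fun t => φ (x + t)) (fun t => v (x + t)) (Ioo 0 δ) k η) :
    PushforwardEstimate φ v (Ioo x (x + δ)) k η := by
  have e : ∀ G : ℝ → ENNReal, ∫⁻ t in Ioo 0 δ, G (x + t) = ∫⁻ y in Ioo x (x + δ), G y := by
    intro G
    have := (measurePreserving_add_left volume x).setLIntegral_comp_preimage_emb
      (measurableEmbedding_addLeft x) G (Ioo x (x + δ))
    rwa [preimage_const_add_Ioo, sub_self, add_sub_cancel_left] at this
  refine ⟨fun f => ?_, ?_⟩
  · rw [← e fun y => ENNReal.ofReal (v y) * f (φ y)]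
    exact h.upper f
  · obtain ⟨b, hb, hl⟩ := h.lower
    refine ⟨b, hb, fun f => ?_⟩
    rw [← e fun y => ENNReal.ofReal (v y) * f (φ y)]
    exact hl f

theorem PushforwardEstimate.comp_sub {φ v : ℝ → ℝ} {x δ k η : ℝ}
    (h : PushforwardEstimate (fun t => φ (x - t)) (fun t => v (x - t)) (Ioo 0 δ) k η) :
    PushforwardEstimate φ v (Ioo (x - δ) x) k η := by
  have e : ∀ G : ℝ → ENNReal, ∫⁻ t in Ioo 0 δ, G (x - t) = ∫⁻ y in Ioo (x - δ) x, G y := by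
    intro G
    have := (Measure.measurePreserving_sub_left volume x).setLIntegral_comp_preimage_emb
      (MeasurableEquiv.subLeft x).measurableEmbedding G (Ioo (x - δ) x)
    rwa [preimage_const_sub_Ioo, sub_self, sub_sub_cancel] at this
  refine ⟨fun f => ?_, ?_⟩
  · rw [← e fun y => ENNReal.ofReal (v y) * f (φ y)]
    exact h.upper f
  · obtain ⟨b, hb, hl⟩ := h.lower
    refine ⟨b, hb, fun f => ?_⟩
    rw [← e fun y => ENNReal.ofReal (v y) * f (φ y)]
    exact hl f

theorem reciprocalSlopes_nonneg {φ : ℝ → ℝ} (hφ : ConditionAlpha φ) {x : ℝ} (hx : x ∈ fibreOne φ) :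
    0 ≤ reciprocalSlopes φ x := by
  unfold reciprocalSlopes
  split_ifs with h0 h1
  · positivity
  · subst h1
    have := hφ.leftDeriv_pos 1 hx zero_lt_one
    positivity
  · have := hφ.leftDeriv_pos x hx (lt_of_le_of_ne hx.1.1 (Ne.symm h0))
    positivity

theorem eventually_pushforwardEstimate_left {φ : ℝ → ℝ} (hφ : ConditionAlpha φ) {v : ℝ → ℝ}
    (hv : ContinuousOn v (Icc 0 1)) {x : ℝ} (hx : x ∈ fibreOne φ) (hx0 : 0 < x) {η : ℝ}
    (hη : 0 < η) :
    ∀ᶠ δ in 𝓝[>] (0:ℝ), PushforwardEstimate φ v (Ioo (x - δ) x) (v x / leftDeriv φ x) η := by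
  obtain ⟨ε, hε, hC, -⟩ := hφ.exists_radius
  have hC := (hC x hx).1
  set θ := min ε x with hθ
  have hθ0 : 0 < θ := lt_min hε hx0
  have hmapS : MapsTo (fun t => x - t) (Icc 0 θ) (Icc (x - ε) x ∩ Icc 0 1) := by
    intro t ht
    have h1 := ht.2.trans (min_le_left _ _)
    have h2 := ht.2.trans (min_le_right _ _)
    have h3 := ht.1
    have h4 := hx.1.2
    exact ⟨⟨by linarith, by linarith⟩, by linarith, by linarith⟩
  have hmem : Icc (x - ε) x ∩ Icc 0 1 ∈ 𝓝[Iic x] x := by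
    have h1 : Ioi (max (x - ε) 0) ∈ 𝓝 x := Ioi_mem_nhds (max_lt (by linarith) hx0)
    filter_upwards [self_mem_nhdsWithin, mem_nhdsWithin_of_mem_nhds h1] with y hy hy'
    have hy' : max (x - ε) 0 < y := hy'
    have h2 := (le_max_left _ _).trans hy'.le
    have h3 := (le_max_right _ _).trans hy'.le
    exact ⟨⟨h2, hy⟩, h3, le_trans hy hx.1.2⟩
  have hd : HasDerivWithinAt φ (leftDeriv φ x) (Iic x) x :=
    ((hC.differentiableOn one_ne_zero x
      ⟨⟨by linarith, le_rfl⟩, hx.1⟩).mono_of_mem_nhdsWithin hmem).hasDerivWithinAt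
  have key := eventually_pushforwardEstimate_Ioo (χ := fun t => φ (x - t)) (v := fun t => v (x - t))
    (m := leftDeriv φ x) hθ0 (hC.comp (by fun_prop) hmapS)
    (fun t ht => hφ.mapsTo (hmapS ht).2) (by simpa using hx.2) (hφ.leftDeriv_pos x hx hx0) ?_ ?_ hη
  · filter_upwards [key] with δ hδ
    refine PushforwardEstimate.comp_sub ?_
    simpa using hδ
  · have h1 : HasDerivWithinAt (fun t : ℝ => x - t) (-1) (Icc 0 θ) 0 := by
      simpa using ((hasDerivAt_id (0:ℝ)).const_sub x).hasDerivWithinAt (s := Icc 0 θ)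
    have h2 : HasDerivWithinAt φ (leftDeriv φ x) (Iic x) (x - 0) := by simpa using hd
    have := h2.comp (0:ℝ) h1 (fun t ht => by simpa using ht.1)
    simpa [Function.comp_def] using this
  · have h2 : ContinuousWithinAt v (Icc 0 1) (x - 0) := by simpa using hv x hx.1
    exact h2.comp (f := fun t => x - t) (by fun_prop) fun t ht => (hmapS ht).2

theorem eventually_pushforwardEstimate_right {φ : ℝ → ℝ} (hφ : ConditionAlpha φ) {v : ℝ → ℝ}
    (hv : ContinuousOn v (Icc 0 1)) {x : ℝ} (hx : x ∈ fibreOne φ) (hx1 : x < 1) {η : ℝ}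
    (hη : 0 < η) :
    ∀ᶠ δ in 𝓝[>] (0:ℝ), PushforwardEstimate φ v (Ioo x (x + δ)) (v x / |rightDeriv φ x|) η := by
  obtain ⟨ε, hε, hC, -⟩ := hφ.exists_radius
  have hC := (hC x hx).2
  set θ := min ε (1 - x) with hθ
  have hθ0 : 0 < θ := lt_min hε (by linarith)
  have hmapS : MapsTo (fun t => x + t) (Icc 0 θ) (Icc x (x + ε) ∩ Icc 0 1) := by
    intro t ht
    have h1 := ht.2.trans (min_le_left _ _)
    have h2 := ht.2.trans (min_le_right _ _)
    have h3 := ht.1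
    have h4 := hx.1.1
    exact ⟨⟨by linarith, by linarith⟩, by linarith, by linarith⟩
  have hmem : Icc x (x + ε) ∩ Icc 0 1 ∈ 𝓝[Ici x] x := by
    have h1 : Iio (min (x + ε) 1) ∈ 𝓝 x := Iio_mem_nhds (lt_min (by linarith) hx1)
    filter_upwards [self_mem_nhdsWithin, mem_nhdsWithin_of_mem_nhds h1] with y hy hy'
    have hy' : y < min (x + ε) 1 := hy'
    have h2 := hy'.le.trans (min_le_left _ _)
    have h3 := hy'.le.trans (min_le_right _ _)
    exact ⟨⟨hy, h2⟩, le_trans hx.1.1 hy, h3⟩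
  have hd : HasDerivWithinAt φ (rightDeriv φ x) (Ici x) x :=
    ((hC.differentiableOn one_ne_zero x
      ⟨⟨le_rfl, by linarith⟩, hx.1⟩).mono_of_mem_nhdsWithin hmem).hasDerivWithinAt
  have hneg := hφ.rightDeriv_neg x hx hx1
  have key := eventually_pushforwardEstimate_Ioo (χ := fun t => φ (x + t)) (v := fun t => v (x + t))
    (m := |rightDeriv φ x|) hθ0 (hC.comp (by fun_prop) hmapS)
    (fun t ht => hφ.mapsTo (hmapS ht).2) (by simpa using hx.2) (abs_pos.2 hneg.ne) ?_ ?_ hη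
  · filter_upwards [key] with δ hδ
    refine PushforwardEstimate.comp_add ?_
    simpa using hδ
  · have h1 : HasDerivWithinAt (fun t : ℝ => x + t) 1 (Icc 0 θ) 0 := by
      simpa using ((hasDerivAt_id (0:ℝ)).const_add x).hasDerivWithinAt (s := Icc 0 θ)
    have h2 : HasDerivWithinAt φ (rightDeriv φ x) (Ici x) (x + 0) := by simpa using hd
    have := h2.comp (0:ℝ) h1 (fun t ht => by simpa using ht.1)
    rw [abs_of_neg hneg, neg_neg]
    simpa [Function.comp_def] using this
  · have h2 : ContinuousWithinAt v (Icc 0 1) (x + 0) := by simpa using hv x hx.1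
    exact h2.comp (f := fun t => x + t) (by fun_prop) fun t ht => (hmapS ht).2

/-- An interior point adds the estimates of its two sides, each with error `η / 2`; an endpoint of
`[0,1]` has one side only. The point itself is a null set. -/
theorem eventually_pushforwardEstimate_point {φ : ℝ → ℝ} (hφ : ConditionAlpha φ) {v : ℝ → ℝ}
    (hv : ContinuousOn v (Icc 0 1)) (hv0 : ∀ x, 0 ≤ v x) {x : ℝ} (hx : x ∈ fibreOne φ) {η : ℝ}
    (hη : 0 < η) :
    ∀ᶠ δ in 𝓝[>] (0:ℝ), PushforwardEstimate φ v (Ioo (x - δ) (x + δ) ∩ Icc 0 1)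
      (v x * reciprocalSlopes φ x) η := by
  have hη2 : 0 < η / 2 := by positivity
  have hvL : 0 < x → 0 ≤ v x / leftDeriv φ x := fun h =>
    div_nonneg (hv0 x) (hφ.leftDeriv_pos x hx h).le
  rcases hx.1.1.eq_or_lt with h0 | h0
  · have h1 : x < 1 := by rw [← h0]; exact zero_lt_one
    filter_upwards [eventually_pushforwardEstimate_right hφ hv hx h1 hη,
      Ioo_mem_nhdsGT (show (0:ℝ) < 1 / 2 by norm_num)] with δ hδ hδ'
    rw [reciprocalSlopes, if_pos h0.symm, mul_one_div]
    refine hδ.congr_set ?_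
    have hsing : ∀ᵐ y : ℝ, y ≠ x := Measure.ae_ne volume x
    filter_upwards [hsing] with y hy
    refine propext ⟨fun h => ?_, fun h => ?_⟩
    · have h2 := h.1
      have h3 := h.2
      have := hδ'.1; have := hδ'.2
      exact ⟨⟨by linarith, h3⟩, by linarith, by linarith⟩
    · exact ⟨lt_of_le_of_ne (h0 ▸ h.2.1) hy.symm, h.1.2⟩
  rcases hx.1.2.eq_or_lt with h1 | h1
  · filter_upwards [eventually_pushforwardEstimate_left hφ hv hx h0 hη,
      Ioo_mem_nhdsGT (show (0:ℝ) < 1 / 2 by norm_num)] with δ hδ hδ'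
    rw [reciprocalSlopes, if_neg h0.ne', if_pos h1, mul_one_div]
    refine hδ.congr_set ?_
    have hsing : ∀ᵐ y : ℝ, y ≠ x := Measure.ae_ne volume x
    filter_upwards [hsing] with y hy
    refine propext ⟨fun h => ?_, fun h => ?_⟩
    · have h2 := h.1
      have h3 := h.2
      have := hδ'.1; have := hδ'.2
      exact ⟨⟨h2, by linarith⟩, by linarith, by linarith⟩
    · exact ⟨h.1.1, lt_of_le_of_ne (h1 ▸ h.2.2) hy⟩
  · have hmin : 0 < min x (1 - x) := lt_min h0 (by linarith)
    filter_upwards [eventually_pushforwardEstimate_left hφ hv hx h0 hη2,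
      eventually_pushforwardEstimate_right hφ hv hx h1 hη2, Ioo_mem_nhdsGT hmin] with δ hl hr hδ
    have hU := PushforwardEstimate.union ?_ measurableSet_Ioo ?_ ?_ hl hr
    · rw [reciprocalSlopes, if_neg h0.ne', if_neg h1.ne, mul_add, mul_one_div, mul_one_div]
      rw [add_halves] at hU
      refine hU.congr_set ?_
      have hsing : ∀ᵐ y : ℝ, y ≠ x := Measure.ae_ne volume x
      filter_upwards [hsing] with y hy
      have g1 := hδ.1
      have g2 := hδ.2.trans_le (min_le_left _ _)
      have g3 := hδ.2.trans_le (min_le_right _ _)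
      refine propext ⟨fun h => ?_, fun h => ?_⟩
      · rcases h with h | h
        · have h2 := h.1; have h3 := h.2
          exact ⟨⟨h2, by linarith⟩, by linarith, by linarith⟩
        · have h2 := h.1; have h3 := h.2
          exact ⟨⟨by linarith, h3⟩, by linarith, by linarith⟩
      · rcases lt_or_gt_of_ne hy with h2 | h2
        · exact Or.inl ⟨h.1.1, h2⟩
        · exact Or.inr ⟨h2, h.1.2⟩
    · rw [Set.disjoint_left]
      intro y hy hy'
      exact absurd hy.2 (not_lt.2 hy'.1.le)
    · have := hvL h0
      positivity
    · have := div_nonneg (hv0 x) (abs_nonneg (rightDeriv φ x))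
      positivity

/-- The part of `[0, 1]` within distance `δ` of the fibre over `1`. -/
def nearFibre (φ : ℝ → ℝ) (δ : ℝ) : Set ℝ :=
  ⋃ x ∈ fibreOne φ, (Ioo (x - δ) (x + δ) ∩ Icc 0 1)

theorem nearFibre_subset (φ : ℝ → ℝ) (δ : ℝ) : nearFibre φ δ ⊆ Icc 0 1 :=
  iUnion₂_subset fun _ _ => inter_subset_right

theorem measurableSet_nearFibre {φ : ℝ → ℝ} (hφ : ConditionAlpha φ) (δ : ℝ) :
    MeasurableSet (nearFibre φ δ) :=
  hφ.finite_fibre.measurableSet_biUnion fun _ _ => measurableSet_Ioo.inter measurableSet_Icc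

theorem eventually_pushforwardEstimate_nearFibre {φ : ℝ → ℝ} (hφ : ConditionAlpha φ) {v : ℝ → ℝ}
    (hv : ContinuousOn v (Icc 0 1)) (hv0 : ∀ x, 0 ≤ v x) {η : ℝ} (hη : 0 < η) :
    ∀ᶠ δ in 𝓝[>] (0:ℝ), PushforwardEstimate φ v (nearFibre φ δ)
      (∑ x ∈ hφ.finite_fibre.toFinset, v x * reciprocalSlopes φ x) η := by
  set s := hφ.finite_fibre.toFinset with hs
  have hms : ∀ x, x ∈ s ↔ x ∈ fibreOne φ := fun x => hφ.finite_fibre.mem_toFinset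
  -- The `+ 1` keeps the quotient meaningful for an empty fibre.
  set η' := η / (s.card + 1) with hη'
  have hη'0 : 0 < η' := by positivity
  have h1 : ∀ᶠ δ in 𝓝[>] (0:ℝ), ∀ x ∈ s, PushforwardEstimate φ v
      (Ioo (x - δ) (x + δ) ∩ Icc 0 1) (v x * reciprocalSlopes φ x) η' := by
    rw [Finset.eventually_all]
    exact fun x hx => eventually_pushforwardEstimate_point hφ hv hv0 ((hms x).1 hx) hη'0
  have h2 : ∀ᶠ δ in 𝓝[>] (0:ℝ), ∀ x ∈ s, ∀ y ∈ s, x ≠ y →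
      Disjoint (Ioo (x - δ) (x + δ) ∩ Icc 0 1) (Ioo (y - δ) (y + δ) ∩ Icc 0 1) := by
    rw [Finset.eventually_all]
    intro x _
    rw [Finset.eventually_all]
    intro y _
    by_cases hxy : x = y
    · exact Eventually.of_forall fun _ h => absurd hxy h
    · have : 0 < |x - y| / 2 := by
        have := abs_pos.2 (sub_ne_zero.2 hxy)
        positivity
      filter_upwards [Ioo_mem_nhdsGT this] with δ hδ _
      refine Disjoint.mono inter_subset_left inter_subset_left ?_
      rw [Set.disjoint_left]
      rintro z ⟨a1, a2⟩ ⟨a3, a4⟩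
      have h := hδ.2
      rcases abs_cases (x - y) with ⟨e, _⟩ | ⟨e, _⟩ <;> rw [e] at h <;> linarith
  filter_upwards [h1, h2] with δ g1 g2
  have h := PushforwardEstimate.biUnion s (fun x => Ioo (x - δ) (x + δ) ∩ Icc 0 1)
    (fun x => v x * reciprocalSlopes φ x) hη'0.le
    (fun x hx => mul_nonneg (hv0 x) (reciprocalSlopes_nonneg hφ ((hms x).1 hx))) g2
    (fun _ _ => measurableSet_Ioo.inter measurableSet_Icc) g1
  have hset : (⋃ x ∈ s, (Ioo (x - δ) (x + δ) ∩ Icc 0 1)) = nearFibre φ δ := by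
    simp only [hms, nearFibre]
  rw [hset] at h
  have hle : s.card * η' ≤ η := by
    rw [hη', mul_div_assoc', div_le_iff₀ (by positivity)]
    nlinarith
  obtain ⟨b, hb, hl⟩ := h.lower
  refine ⟨fun f => (h.upper f).trans ?_, b, hb, fun f => le_trans ?_ (hl f)⟩
  · exact mul_le_mul_left (ENNReal.ofReal_le_ofReal (by linarith)) _
  · exact mul_le_mul_left (ENNReal.ofReal_le_ofReal (by linarith)) _

/-- `φ` need not be continuous far from the fibre; there the bound `α` applies. Within distance `ε`
it is continuous on closed one-sided intervals, so it attains a maximum on the compact part outside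
the open `δ`-neighbourhood, and this maximum is below `1`. -/
theorem exists_bound_off_nearFibre {φ : ℝ → ℝ} (hφ : ConditionAlpha φ) {δ : ℝ} (hδ : 0 < δ) :
    ∃ a ∈ Ioo (0:ℝ) 1, ∀ y ∈ Icc (0:ℝ) 1, y ∉ nearFibre φ δ → φ y ≤ a := by
  obtain ⟨ε, hε, hC, α, hα, hfar⟩ := hφ.exists_radius
  set U : Set ℝ := ⋃ x ∈ fibreOne φ, Ioo (x - δ) (x + δ) with hU
  have hUo : IsOpen U := isOpen_biUnion fun _ _ => isOpen_Ioo
  have hlt : ∀ y ∈ Icc (0:ℝ) 1, y ∉ U → φ y < 1 := by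
    intro y hy hyU
    refine lt_of_le_of_ne (hφ.mapsTo hy).2 fun h => hyU ?_
    exact mem_biUnion (show y ∈ fibreOne φ from ⟨hy, h⟩) ⟨by linarith, by linarith⟩
  have hcomp : ∀ S : Set ℝ, IsClosed S → ContinuousOn φ (S ∩ Icc 0 1) →
      ∀ᶠ a in 𝓝[<] (1:ℝ), ∀ y ∈ S ∩ Icc 0 1, y ∉ U → φ y ≤ a := by
    intro S hS hc
    have hK : IsCompact ((S ∩ Icc 0 1) ∩ Uᶜ) :=
      (isCompact_Icc.inter_left hS).inter_right hUo.isClosed_compl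
    rcases ((S ∩ Icc 0 1) ∩ Uᶜ).eq_empty_or_nonempty with he | hne
    · refine Eventually.of_forall fun a y hy hyU => ?_
      have : y ∈ (S ∩ Icc 0 1) ∩ Uᶜ := ⟨hy, hyU⟩
      rw [he] at this
      exact absurd this (notMem_empty y)
    · obtain ⟨z, hz, hmax⟩ := hK.exists_isMaxOn hne (hc.mono inter_subset_left)
      filter_upwards [Ioo_mem_nhdsLT (hlt z hz.1.2 hz.2)] with a ha y hy hyU
      exact (hmax (show y ∈ (S ∩ Icc 0 1) ∩ Uᶜ from ⟨hy, hyU⟩)).trans ha.1.le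
  have h1 : ∀ᶠ a in 𝓝[<] (1:ℝ), ∀ x ∈ fibreOne φ,
      (∀ y ∈ Icc (x - ε) x ∩ Icc 0 1, y ∉ U → φ y ≤ a) ∧
      (∀ y ∈ Icc x (x + ε) ∩ Icc 0 1, y ∉ U → φ y ≤ a) := by
    rw [hφ.finite_fibre.eventually_all]
    exact fun x hx => (hcomp _ isClosed_Icc (hC x hx).1.continuousOn).and
      (hcomp _ isClosed_Icc (hC x hx).2.continuousOn)
  have h2 : ∀ᶠ a in 𝓝[<] (1:ℝ), a ∈ Ioo α 1 := Ioo_mem_nhdsLT hα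
  have h3 : ∀ᶠ a in 𝓝[<] (1:ℝ), a ∈ Ioo (0:ℝ) 1 := Ioo_mem_nhdsLT zero_lt_one
  obtain ⟨a, ha1, ha2, ha3⟩ := (h1.and (h2.and h3)).exists
  refine ⟨a, ha3, fun y hy hyN => ?_⟩
  have hyU : y ∉ U := by
    intro h
    obtain ⟨x, hx, hxy⟩ := mem_iUnion₂.1 h
    exact hyN (mem_biUnion hx ⟨hxy, hy⟩)
  by_cases hye : y ∈ ⋃ x ∈ fibreOne φ, Ioo (x - ε) (x + ε)
  · obtain ⟨x, hx, hxy⟩ := mem_iUnion₂.1 hye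
    rcases le_total y x with h | h
    · exact (ha1 x hx).1 y ⟨⟨hxy.1.le, h⟩, hy⟩ hyU
    · exact (ha1 x hx).2 y ⟨⟨h, hxy.2.le⟩, hy⟩ hyU
  · exact (hfar y hy hye).trans ha2.1.le

/-! ### Linear choice of representatives and compactness of restriction -/

theorem enorm_eq_lintegral_of_ae_eq {f : L1Unit} {g : ℝ → ℂ} (h : f =ᵐ[unitMeasure] g) :
    ‖f‖ₑ = ∫⁻ x in Icc 0 1, ‖g x‖ₑ := by
  rw [Lp.enorm_def, eLpNorm_one_eq_lintegral_enorm]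
  exact lintegral_congr_ae (h.mono fun x hx => by simp [hx])

theorem norm_le_mul_of_enorm_le {E F : Type*} [NormedAddCommGroup E] [NormedAddCommGroup F] {x : E}
    {y : F} {C : ℝ} (hC : 0 ≤ C) (h : ‖y‖ₑ ≤ ENNReal.ofReal C * ‖x‖ₑ) : ‖y‖ ≤ C * ‖x‖ := by
  rw [← ofReal_norm, ← ofReal_norm, ← ENNReal.ofReal_mul hC] at h
  exact (ENNReal.ofReal_le_ofReal_iff (by positivity)).1 h

/-- A linear choice of representatives of the elements of the Müntz space, continuous on `[0, 1)`
and vanishing elsewhere, together with moduli of continuity for them. -/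
structure MuntzRep (Λ : ℕ → ℝ) where
  /-- The representative. -/
  rep : muntzSpace Λ →ₗ[ℂ] (ℝ → ℂ)
  /-- The moduli of continuity on the intervals `[0, a]`. -/
  modulus : ℝ → ℝ → ℝ → ℝ
  isMuntzModulus : ∀ a ∈ Ioo (0:ℝ) 1, IsMuntzModulus a (modulus a)
  continuousOn : ∀ f, ContinuousOn (rep f) (Ico 0 1)
  measurable : ∀ f, Measurable (rep f)
  ae_eq : ∀ f : muntzSpace Λ, (f : L1Unit) =ᵐ[unitMeasure] rep f
  map_zero : ∀ f, rep f 0 = 0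
  norm_sub_le : ∀ f, ∀ a ∈ Ioo (0:ℝ) 1, ∀ x ∈ Icc 0 a, ∀ y ∈ Icc 0 a,
    ‖rep f x - rep f y‖ ≤ modulus a x y * ‖f‖

/-- Linearity comes from uniqueness of the continuous representative. Cutting off outside `[0, 1)`
makes it hold on all of `ℝ` and gives measurability. -/
theorem nonempty_muntzRep {Λ : ℕ → ℝ} (hpos : ∀ n, 0 < Λ n) (hsum : Summable fun n => 1 / Λ n) :
    Nonempty (MuntzRep Λ) := by
  obtain ⟨ω, hω, h⟩ := exists_rep hpos hsum
  choose g hc hae h0 hb using fun f : muntzSpace Λ => h f f.2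
  have hadd : ∀ f₁ f₂, ∀ x ∈ Ico (0:ℝ) 1, g (f₁ + f₂) x = g f₁ x + g f₂ x := by
    intro f₁ f₂
    refine eqOn_Ico_of_ae_eq (hc _) ((hc f₁).add (hc f₂)) ?_
    filter_upwards [hae (f₁ + f₂), hae f₁, hae f₂, Lp.coeFn_add (f₁ : L1Unit) (f₂ : L1Unit)]
      with x h1 h2 h3 h4
    rw [← h1, ← h2, ← h3, Submodule.coe_add, h4, Pi.add_apply]
  have hsmul : ∀ (b : ℂ) f, ∀ x ∈ Ico (0:ℝ) 1, g (b • f) x = b * g f x := by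
    intro b f
    refine eqOn_Ico_of_ae_eq (hc _) (continuousOn_const.mul (hc f)) ?_
    filter_upwards [hae (b • f), hae f, Lp.coeFn_smul b (f : L1Unit)] with x h1 h2 h3
    rw [← h1, ← h2, Submodule.coe_smul, h3, Pi.smul_apply, smul_eq_mul]
  have hin : ∀ f, ∀ x ∈ Ico (0:ℝ) 1, indicator (Ico 0 1) (g f) x = g f x := fun f x hx =>
    indicator_of_mem hx _
  have hsub : ∀ a ∈ Ioo (0:ℝ) 1, Icc 0 a ⊆ Ico 0 1 := fun a ha x hx =>
    ⟨hx.1, hx.2.trans_lt ha.2⟩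
  refine ⟨⟨{ toFun := fun f => indicator (Ico 0 1) (g f), map_add' := ?_, map_smul' := ?_ },
    ω, hω, fun f => ?_, fun f => ?_, fun f => ?_, fun f => ?_, fun f a ha x hx y hy => ?_⟩⟩
  · intro f₁ f₂
    funext x
    by_cases hx : x ∈ Ico (0:ℝ) 1
    · simp [hin _ x hx, hadd f₁ f₂ x hx]
    · simp [indicator_of_notMem hx]
  · intro b f
    funext x
    by_cases hx : x ∈ Ico (0:ℝ) 1
    · simp [hin _ x hx, hsmul b f x hx]
    · simp [indicator_of_notMem hx]
  · exact (hc f).congr (hin f)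
  · have : Measurable (piecewise (Ico (0:ℝ) 1) (g f) 0) :=
      (hc f).measurable_piecewise continuousOn_const measurableSet_Ico
    rwa [piecewise_eq_indicator] at this
  · filter_upwards [hae f, ae_unitMeasure_mem_Ico] with x h1 h2
    exact h1.trans (hin f x h2).symm
  · exact (hin f 0 (by simp)).trans (h0 f)
  · change ‖indicator (Ico 0 1) (g f) x - indicator (Ico 0 1) (g f) y‖ ≤ _
    rw [hin f x (hsub a ha hx), hin f y (hsub a ha hy)]
    exact hb f a ha x hx y hy

namespace MuntzRep

variable {Λ : ℕ → ℝ}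

theorem exists_norm_le (ρ : MuntzRep Λ) {a : ℝ} (ha : a ∈ Ioo (0:ℝ) 1) :
    ∃ B, 0 ≤ B ∧ ∀ f, ∀ x ∈ Icc 0 a, ‖ρ.rep f x‖ ≤ B * ‖f‖ := by
  have h0 : (0:ℝ) ∈ Icc 0 a := ⟨le_rfl, ha.1.le⟩
  obtain ⟨B, hB⟩ := (ρ.isMuntzModulus a ha).bdd
  refine ⟨B, (hB 0 h0 0 h0).1.trans (hB 0 h0 0 h0).2, fun f x hx => ?_⟩
  have := ρ.norm_sub_le f a ha x hx 0 h0
  rw [ρ.map_zero, sub_zero] at this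
  exact this.trans (mul_le_mul_of_nonneg_right (hB x hx 0 h0).2 (norm_nonneg _))

/-- Restriction to `[0, a]` is a compact operator from the Müntz space to `C([0, a])`. -/
theorem exists_compact_restriction (ρ : MuntzRep Λ) {a : ℝ} (ha : a ∈ Ioo (0:ℝ) 1) :
    ∃ S : muntzSpace Λ →L[ℂ] BoundedContinuousFunction (Icc 0 a) ℂ, IsCompactOperator S ∧
      ∀ f x, S f x = ρ.rep f x := by
  obtain ⟨B, hB0, hB⟩ := ρ.exists_norm_le ha
  have hsub : Icc 0 a ⊆ Ico 0 1 := fun x hx => ⟨hx.1, hx.2.trans_lt ha.2⟩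
  let S : muntzSpace Λ →ₗ[ℂ] BoundedContinuousFunction (Icc 0 a) ℂ :=
    { toFun := fun f => BoundedContinuousFunction.mkOfCompact
        ⟨(Icc 0 a).domRestrict (ρ.rep f), ((ρ.continuousOn f).mono hsub).domRestrict⟩
      map_add' := fun f g => by
        ext x
        change ρ.rep (f + g) x = ρ.rep f x + ρ.rep g x
        rw [map_add, Pi.add_apply]
      map_smul' := fun b f => by
        ext x
        change ρ.rep (b • f) x = b • ρ.rep f x
        rw [map_smul, Pi.smul_apply] }
  have hS : ∀ f x, S f x = ρ.rep f x := fun f x => rfl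
  have hSn : ∀ f, ‖S f‖ ≤ B * ‖f‖ := fun f =>
    (BoundedContinuousFunction.norm_le (by positivity)).2 fun x => hB f x x.2
  refine ⟨S.mkContinuous B hSn, ?_, hS⟩
  refine (isCompactOperator_iff_isCompact_closure_image_closedBall
    S zero_lt_one).2 ?_
  -- The unit ball has values in the disc of radius `B`, and its common modulus of continuity gives
  -- equicontinuity.
  refine BoundedContinuousFunction.arzela_ascoli (Metric.closedBall 0 B)
    (isCompact_closedBall 0 B) _ ?_ ?_
  · rintro _ x ⟨f, hf, rfl⟩
    rw [mem_closedBall_zero_iff] at hf ⊢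
    refine (hB f x x.2).trans ?_
    nlinarith
  · intro x
    rw [Metric.equicontinuousAt_iff_right]
    intro ε hε
    have h1 := (ρ.isMuntzModulus a ha).tendsto x x.2
    have h2 : Tendsto (fun y : Icc 0 a => ρ.modulus a x y) (𝓝 x) (𝓝 0) := by
      refine h1.comp (tendsto_nhdsWithin_iff.2 ⟨continuous_subtype_val.tendsto x, ?_⟩)
      exact Eventually.of_forall fun y => y.2
    filter_upwards [h2.eventually (gt_mem_nhds hε)] with y hy
    rintro ⟨_, f, hf, rfl⟩
    rw [mem_closedBall_zero_iff] at hf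
    rw [dist_eq_norm]
    have h3 := ρ.norm_sub_le f a ha x x.2 y y.2
    obtain ⟨B', hB'⟩ := (ρ.isMuntzModulus a ha).bdd
    have h4 := (hB' x x.2 y y.2).1
    refine lt_of_le_of_lt (h3.trans ?_) hy
    exact mul_le_of_le_one_right h4 hf

end MuntzRep

/-! ### The weighted composition operator and the upper bound -/

theorem exists_norm_le_of_continuousOn_Icc {ψ : ℝ → ℂ} (hψ : ContinuousOn ψ (Icc 0 1)) :
    ∃ M, 0 ≤ M ∧ ∀ x ∈ Icc (0:ℝ) 1, ‖ψ x‖ ≤ M := by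
  obtain ⟨M, hM⟩ := isCompact_Icc.exists_bound_of_continuousOn hψ
  exact ⟨M, (norm_nonneg _).trans (hM 0 (by simp)), hM⟩

/-- The weighted composition operator from `C([0, a])` to `L¹`, cut off outside `A`. -/
theorem exists_cutoff_composition {φ : ℝ → ℝ} (hφ : AEMeasurable φ unitMeasure) {ψ : ℝ → ℂ}
    (hψ : ContinuousOn ψ (Icc 0 1)) {A : Set ℝ} (hA : MeasurableSet A) {a : ℝ} (ha : 0 ≤ a) :
    ∃ V : BoundedContinuousFunction (Icc 0 a) ℂ →L[ℂ] L1Unit, ∀ h,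
      V h =ᵐ[unitMeasure] A.indicator fun x => ψ x * h (projIcc 0 a ha (φ x)) := by
  obtain ⟨M, hM0, hM⟩ := exists_norm_le_of_continuousOn_Icc hψ
  -- `projIcc` only makes the composition total; it has no effect at points where `φ` takes values
  -- in `[0, a]`.
  set F : BoundedContinuousFunction (Icc 0 a) ℂ → ℝ → ℂ :=
    fun h => A.indicator fun x => ψ x * h (projIcc 0 a ha (φ x)) with hF
  have hmeas : ∀ h, AEStronglyMeasurable (F h) unitMeasure := by
    intro h
    refine AEStronglyMeasurable.indicator ?_ hA
    refine (hψ.aestronglyMeasurable measurableSet_Icc).mul ?_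
    exact ((h.continuous.comp continuous_projIcc).measurable.comp_aemeasurable
      hφ).aestronglyMeasurable
  have hbd : ∀ h, ∀ᵐ x ∂unitMeasure, ‖F h x‖ ≤ M * ‖h‖ := by
    intro h
    filter_upwards [ae_restrict_mem measurableSet_Icc] with x hx
    refine (norm_indicator_le_norm_self _ _).trans ?_
    rw [norm_mul]
    exact mul_le_mul (hM x hx) (h.norm_coe_le_norm _) (norm_nonneg _) hM0
  have hmem : ∀ h, MemLp (F h) 1 unitMeasure := fun h => MemLp.of_bound (hmeas h) _ (hbd h)
  let V : BoundedContinuousFunction (Icc 0 a) ℂ →ₗ[ℂ] L1Unit :=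
    { toFun := fun h => (hmem h).toLp
      map_add' := fun h k => by
        rw [← MemLp.toLp_add]
        congr 1
        funext x
        by_cases hx : x ∈ A
        · simp [hF, hx, mul_add]
        · simp [hF, hx]
      map_smul' := fun b h => by
        rw [RingHom.id_apply, ← MemLp.toLp_const_smul]
        congr 1
        funext x
        by_cases hx : x ∈ A
        · simp [hF, hx, mul_left_comm]
        · simp [hF, hx] }
  refine ⟨V.mkContinuous M fun h => ?_, fun h => (hmem h).coeFn_toLp⟩
  change ‖(hmem h).toLp‖ ≤ _
  have h1 : ‖(hmem h).toLp‖ = ∫ x, ‖F h x‖ ∂unitMeasure := by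
    rw [L1.norm_eq_integral_norm]
    exact integral_congr_ae ((hmem h).coeFn_toLp.mono fun x hx => by simp [hx])
  rw [h1]
  refine (integral_mono_ae (memLp_one_iff_integrable.1 (hmem h)).norm (integrable_const _)
    (hbd h)).trans ?_
  simp

theorem ConditionAlpha.ae_mem_Ico {φ : ℝ → ℝ} (hφ : ConditionAlpha φ) :
    ∀ᵐ x ∂unitMeasure, φ x ∈ Ico (0:ℝ) 1 := by
  have h1 : ∀ᵐ x ∂unitMeasure, x ∉ fibreOne φ :=
    ae_restrict_of_ae (measure_eq_zero_iff_ae_notMem.1 (hφ.finite_fibre.measure_zero volume))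
  filter_upwards [h1, ae_restrict_mem measurableSet_Icc] with x hx hx'
  have h := hφ.mapsTo hx'
  exact ⟨h.1, lt_of_le_of_ne h.2 fun e => hx ⟨hx', e⟩⟩

theorem unitMeasure_restrict_nearFibre (φ : ℝ → ℝ) (δ : ℝ) :
    unitMeasure.restrict (nearFibre φ δ) = volume.restrict (nearFibre φ δ) :=
  Measure.restrict_restrict_of_subset (nearFibre_subset φ δ)

/-- Continuous representatives agree everywhere on `[0, 1)`, and `φ` takes values there almost
everywhere since the fibre is finite. Hence the choice of `g` in `IsWeightedComposition` does not
matter, which also gives uniqueness of the operator. -/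
theorem IsWeightedComposition.ae_eq_rep {Λ : ℕ → ℝ} (ρ : MuntzRep Λ) {φ : ℝ → ℝ}
    (hφ : ConditionAlpha φ) {ψ : ℝ → ℂ} {T : muntzSpace Λ →L[ℂ] L1Unit}
    (hT : IsWeightedComposition Λ φ ψ T) (f : muntzSpace Λ) :
    T f =ᵐ[unitMeasure] fun x => ψ x * ρ.rep f (φ x) := by
  obtain ⟨g, hg, hfg, hTg⟩ := hT f
  have h := eqOn_Ico_of_ae_eq (ρ.continuousOn f) hg ((ρ.ae_eq f).symm.trans hfg)
  filter_upwards [hTg, hφ.ae_mem_Ico] with x h1 h2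
  rw [h1, h h2]

theorem lintegral_nearFibre_le {Λ : ℕ → ℝ} (ρ : MuntzRep Λ) {φ : ℝ → ℝ} {ψ : ℝ → ℂ} {δ k η : ℝ}
    (hN : PushforwardEstimate φ (fun x => ‖ψ x‖) (nearFibre φ δ) k η) (f : muntzSpace Λ) :
    ∫⁻ x in nearFibre φ δ, ‖ψ x * ρ.rep f (φ x)‖ₑ ≤ ENNReal.ofReal (k + η) * ‖f‖ₑ := by
  have h1 := hN.upper fun u => ‖ρ.rep f u‖ₑ
  rw [← enorm_eq_lintegral_of_ae_eq (ρ.ae_eq f)] at h1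
  refine le_trans (le_of_eq (lintegral_congr fun x => ?_)) h1
  rw [enorm_mul, ofReal_norm]

/-- Boundedness: near the fibre by the push-forward estimate with error `1`, elsewhere by the sup
bound `M * B` on a set of measure at most one. -/
theorem exists_isWeightedComposition {Λ : ℕ → ℝ} (ρ : MuntzRep Λ) {φ : ℝ → ℝ}
    (hφ : ConditionAlpha φ) {ψ : ℝ → ℂ} (hψ : ContinuousOn ψ (Icc 0 1)) :
    ∃ T : muntzSpace Λ →L[ℂ] L1Unit, IsWeightedComposition Λ φ ψ T := by
  set k := ∑ x ∈ hφ.finite_fibre.toFinset, ‖ψ x‖ * reciprocalSlopes φ x with hk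
  have hk0 : 0 ≤ k := Finset.sum_nonneg fun x hx =>
    mul_nonneg (norm_nonneg _) (reciprocalSlopes_nonneg hφ (hφ.finite_fibre.mem_toFinset.1 hx))
  obtain ⟨δ, hN, hδ⟩ := ((eventually_pushforwardEstimate_nearFibre hφ hψ.norm
    (fun x => norm_nonneg _) zero_lt_one).and self_mem_nhdsWithin).exists
  obtain ⟨a, ha, hfar⟩ := exists_bound_off_nearFibre hφ (mem_Ioi.1 hδ)
  obtain ⟨B, hB0, hB⟩ := ρ.exists_norm_le ha
  obtain ⟨M, hM0, hM⟩ := exists_norm_le_of_continuousOn_Icc hψ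
  have hmeas : ∀ f, AEStronglyMeasurable (fun x => ψ x * ρ.rep f (φ x)) unitMeasure := fun f =>
    (hψ.aestronglyMeasurable measurableSet_Icc).mul
      ((ρ.measurable f).comp_aemeasurable hφ.aemeasurable).aestronglyMeasurable
  have hbd : ∀ f : muntzSpace Λ, ∫⁻ x in Icc 0 1, ‖ψ x * ρ.rep f (φ x)‖ₑ ≤
      ENNReal.ofReal (k + 1 + M * B) * ‖f‖ₑ := by
    intro f
    rw [← lintegral_inter_add_sdiff _ (Icc (0:ℝ) 1) (measurableSet_nearFibre hφ δ),
      inter_eq_right.2 (nearFibre_subset φ δ), ENNReal.ofReal_add (by positivity) (by positivity),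
      add_mul]
    refine add_le_add (lintegral_nearFibre_le ρ hN f) ?_
    calc ∫⁻ x in Icc 0 1 \ nearFibre φ δ, ‖ψ x * ρ.rep f (φ x)‖ₑ
        ≤ ∫⁻ x in Icc 0 1 \ nearFibre φ δ, ENNReal.ofReal (M * B) * ‖f‖ₑ := by
          refine setLIntegral_mono' (measurableSet_Icc.diff (measurableSet_nearFibre hφ δ))
            fun x hx => ?_
          rw [← ofReal_norm, ← ofReal_norm, ← ENNReal.ofReal_mul (by positivity), norm_mul,
            mul_assoc]
          refine ENNReal.ofReal_le_ofReal (mul_le_mul (hM x hx.1) ?_ (norm_nonneg _) hM0)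
          exact hB f _ ⟨(hφ.mapsTo hx.1).1, hfar x hx.1 hx.2⟩
      _ ≤ ∫⁻ x in Icc (0:ℝ) 1, ENNReal.ofReal (M * B) * ‖f‖ₑ := lintegral_mono_set sdiff_subset
      _ = _ := by simp
  have hmem : ∀ f, MemLp (fun x => ψ x * ρ.rep f (φ x)) 1 unitMeasure := by
    intro f
    refine ⟨hmeas f, ?_⟩
    rw [eLpNorm_one_eq_lintegral_enorm]
    exact (hbd f).trans_lt (ENNReal.mul_lt_top ENNReal.ofReal_lt_top enorm_lt_top)
  let T : muntzSpace Λ →ₗ[ℂ] L1Unit :=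
    { toFun := fun f => (hmem f).toLp
      map_add' := fun f g => by
        rw [← MemLp.toLp_add]
        congr 1
        funext x
        simp [mul_add]
      map_smul' := fun b f => by
        rw [RingHom.id_apply, ← MemLp.toLp_const_smul]
        congr 1
        funext x
        simp [mul_left_comm] }
  refine ⟨T.mkContinuous (k + 1 + M * B) fun f => ?_, fun f =>
    ⟨ρ.rep f, ρ.continuousOn f, ρ.ae_eq f, (hmem f).coeFn_toLp⟩⟩
  refine norm_le_mul_of_enorm_le (by positivity) ?_
  change ‖(hmem f).toLp‖ₑ ≤ _
  rw [enorm_eq_lintegral_of_ae_eq (hmem f).coeFn_toLp]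
  exact hbd f

/-- `K` is the operator cut off to the complement of `nearFibre φ δ`. It factors through the compact
restriction to `C([0, a])`, and `T - K` lives on `nearFibre φ δ`, where the push-forward estimate
bounds it. -/
theorem exists_compact_norm_sub_le {Λ : ℕ → ℝ} (ρ : MuntzRep Λ) {φ : ℝ → ℝ}
    (hφ : ConditionAlpha φ) {ψ : ℝ → ℂ} (hψ : ContinuousOn ψ (Icc 0 1)) {T : muntzSpace Λ →L[ℂ] L1Unit}
    (hT : IsWeightedComposition Λ φ ψ T) {η : ℝ} (hη : 0 < η) :
    ∃ K : muntzSpace Λ →L[ℂ] L1Unit, IsCompactOperator K ∧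
      ‖T - K‖ ≤ ∑ x ∈ hφ.finite_fibre.toFinset, ‖ψ x‖ * reciprocalSlopes φ x + η := by
  set k := ∑ x ∈ hφ.finite_fibre.toFinset, ‖ψ x‖ * reciprocalSlopes φ x with hk
  have hk0 : 0 ≤ k := Finset.sum_nonneg fun x hx =>
    mul_nonneg (norm_nonneg _) (reciprocalSlopes_nonneg hφ (hφ.finite_fibre.mem_toFinset.1 hx))
  obtain ⟨δ, hN, hδ⟩ := ((eventually_pushforwardEstimate_nearFibre hφ hψ.norm
    (fun x => norm_nonneg _) hη).and self_mem_nhdsWithin).exists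
  obtain ⟨a, ha, hfar⟩ := exists_bound_off_nearFibre hφ (mem_Ioi.1 hδ)
  obtain ⟨S, hS, hSr⟩ := ρ.exists_compact_restriction ha
  have hNm := measurableSet_nearFibre hφ δ
  obtain ⟨V, hV⟩ := exists_cutoff_composition hφ.aemeasurable hψ hNm.compl ha.1.le
  refine ⟨V.comp S, hS.clm_comp V, ?_⟩
  refine ContinuousLinearMap.opNorm_le_bound _ (by positivity) fun f => ?_
  refine norm_le_mul_of_enorm_le (by positivity) (le_trans (le_of_eq ?_)
    (lintegral_nearFibre_le ρ hN f))
  have hae : ((T - V.comp S) f : L1Unit) =ᵐ[unitMeasure]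
      (nearFibre φ δ).indicator fun x => ψ x * ρ.rep f (φ x) := by
    rw [_root_.sub_apply]
    filter_upwards [Lp.coeFn_sub (T f) (V.comp S f), hT.ae_eq_rep ρ hφ f, hV (S f),
      ae_restrict_mem measurableSet_Icc] with x h1 h2 h3 hx
    rw [h1, Pi.sub_apply, h2, ContinuousLinearMap.comp_apply, h3]
    by_cases hxN : x ∈ nearFibre φ δ
    · rw [indicator_of_mem hxN, indicator_of_notMem (by simpa using hxN), sub_zero]
    · have hφx : φ x ∈ Icc 0 a := ⟨(hφ.mapsTo hx).1, hfar x hx hxN⟩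
      rw [indicator_of_notMem hxN, indicator_of_mem (show x ∈ (nearFibre φ δ)ᶜ from hxN), hSr,
        projIcc_of_mem ha.1.le hφx, sub_self]
  rw [enorm_eq_lintegral_of_ae_eq hae, ← unitMeasure_restrict_nearFibre,
    ← lintegral_indicator hNm]
  refine lintegral_congr fun x => ?_
  by_cases hxN : x ∈ nearFibre φ δ <;> simp [hxN]

/-! ### The lower bound -/

theorem tendsto_volume_nearFibre {φ : ℝ → ℝ} (hφ : ConditionAlpha φ) :
    Tendsto (fun δ => unitMeasure (nearFibre φ δ)) (𝓝[>] 0) (𝓝 0) := by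
  have h1 : ∀ δ, unitMeasure (nearFibre φ δ) ≤
      ∑ x ∈ hφ.finite_fibre.toFinset, ENNReal.ofReal (2 * δ) := by
    intro δ
    have hs : nearFibre φ δ ⊆ ⋃ x ∈ hφ.finite_fibre.toFinset, Ioo (x - δ) (x + δ) := by
      simp only [hφ.finite_fibre.mem_toFinset]
      exact iUnion₂_mono fun x _ => inter_subset_left
    refine (Measure.restrict_apply_le _ _).trans ((measure_mono hs).trans
      ((measure_biUnion_finset_le _ _).trans (Finset.sum_le_sum fun x _ => ?_)))
    rw [Real.volume_Ioo]
    exact ENNReal.ofReal_le_ofReal (by linarith)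
  refine tendsto_of_tendsto_of_tendsto_of_le_of_le tendsto_const_nhds ?_ (fun _ => bot_le) h1
  rw [show (0 : ENNReal) = ∑ x ∈ hφ.finite_fibre.toFinset, 0 by simp]
  refine tendsto_finsetSum _ fun x _ => ?_
  have : Tendsto (fun δ : ℝ => ENNReal.ofReal (2 * δ)) (𝓝 0) (𝓝 (ENNReal.ofReal (2 * 0))) :=
    ENNReal.tendsto_ofReal (tendsto_id.const_mul 2)
  rw [mul_zero, ENNReal.ofReal_zero] at this
  exact this.mono_left nhdsWithin_le_nhds

theorem lintegral_Ioo_rpow {l b : ℝ} (hl : 0 < l) (hb : b ∈ Ico (0:ℝ) 1) :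
    ∫⁻ x in Ioo b 1, ‖((l + 1 : ℝ) : ℂ) * ((x ^ l : ℝ) : ℂ)‖ₑ =
      ENNReal.ofReal (1 - b ^ (l + 1)) := by
  have h1 : ∫ x in b..1, (l + 1) * x ^ l = 1 - b ^ (l + 1) := by
    rw [intervalIntegral.integral_const_mul, integral_rpow (Or.inl (by linarith)), Real.one_rpow]
    field_simp
  have hint : IntervalIntegrable (fun x : ℝ => (l + 1) * x ^ l) volume b 1 :=
    (intervalIntegral.intervalIntegrable_rpow' (by linarith)).const_mul _
  rw [intervalIntegrable_iff_integrableOn_Ioo_of_le hb.2.le] at hint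
  rw [← h1, intervalIntegral.integral_of_le hb.2.le, integral_Ioc_eq_integral_Ioo,
    ofReal_integral_eq_lintegral_ofReal hint]
  · refine setLIntegral_congr_fun measurableSet_Ioo fun x hx => ?_
    have hx0 : 0 ≤ x := hb.1.trans hx.1.le
    rw [← Complex.ofReal_mul, ← ofReal_norm, Complex.norm_real, Real.norm_of_nonneg (by positivity)]
  · filter_upwards [ae_restrict_mem measurableSet_Ioo] with x hx
    have hx0 : 0 ≤ x := hb.1.trans hx.1.le
    simp only [Pi.zero_apply]
    positivity

theorem tendsto_atTop_of_summable_one_div {Λ : ℕ → ℝ} (hpos : ∀ n, 0 < Λ n)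
    (hsum : Summable fun n => 1 / Λ n) : Tendsto Λ atTop atTop := by
  have h : Tendsto (fun n => 1 / Λ n) atTop (𝓝[>] 0) :=
    tendsto_nhdsWithin_iff.2 ⟨hsum.tendsto_atTop_zero,
      Eventually.of_forall fun n => one_div_pos.2 (hpos n)⟩
  refine (tendsto_inv_nhdsGT_zero.comp h).congr fun n => ?_
  simp

/-- The functions `(Λ n + 1) x ^ Λ n` have norm one, and their mass on `[0, b]` is `b ^ (Λ n + 1)`,
which tends to `0` since `Λ n → ∞`. -/
theorem exists_normalized_powers {Λ : ℕ → ℝ} (hpos : ∀ n, 0 < Λ n)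
    (hsum : Summable fun n => 1 / Λ n) (ρ : MuntzRep Λ) :
    ∃ e : ℕ → muntzSpace Λ, (∀ n, ‖e n‖ = 1) ∧ ∀ b ∈ Ico (0:ℝ) 1,
      Tendsto (fun n => ∫⁻ u in Ioo b 1, ‖ρ.rep (e n) u‖ₑ) atTop (𝓝 1) := by
  have hcont : ∀ n, Continuous fun x : ℝ => ((x ^ Λ n : ℝ) : ℂ) := fun n =>
    Complex.continuous_ofReal.comp (Real.continuous_rpow_const (hpos n).le)
  have hmem : ∀ n, MemLp (fun x : ℝ => ((x ^ Λ n : ℝ) : ℂ)) 1 unitMeasure := fun n =>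
    memLp_one_iff_integrable.2 ((hcont n).continuousOn.integrableOn_compact isCompact_Icc)
  have hM : ∀ n, (hmem n).toLp ∈ muntzSpace Λ := fun n =>
    subset_closure (Submodule.subset_span ⟨n, (hmem n).coeFn_toLp⟩)
  set e : ℕ → muntzSpace Λ := fun n => ((Λ n + 1 : ℝ) : ℂ) • ⟨(hmem n).toLp, hM n⟩ with he
  have hae : ∀ n, (e n : L1Unit) =ᵐ[unitMeasure]
      fun x => ((Λ n + 1 : ℝ) : ℂ) * ((x ^ Λ n : ℝ) : ℂ) := by
    intro n
    rw [he, Submodule.coe_smul]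
    filter_upwards [Lp.coeFn_smul ((Λ n + 1 : ℝ) : ℂ) (hmem n).toLp, (hmem n).coeFn_toLp]
      with x h1 h2
    rw [h1, Pi.smul_apply, h2, smul_eq_mul]
  have hrep : ∀ n, EqOn (ρ.rep (e n)) (fun x => ((Λ n + 1 : ℝ) : ℂ) * ((x ^ Λ n : ℝ) : ℂ))
      (Ico 0 1) := fun n =>
    eqOn_Ico_of_ae_eq (ρ.continuousOn _) (continuous_const.mul (hcont n)).continuousOn
      ((ρ.ae_eq _).symm.trans (hae n))
  refine ⟨e, fun n => ?_, fun b hb => ?_⟩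
  · have h1 : ‖(e n : L1Unit)‖ₑ = 1 := by
      rw [enorm_eq_lintegral_of_ae_eq (hae n), setLIntegral_congr Ioo_ae_eq_Icc.symm,
        lintegral_Ioo_rpow (hpos n) (by simp), Real.zero_rpow (by linarith [hpos n])]
      simp
    have h2 : ‖(e n : L1Unit)‖ = 1 := by
      rw [← toReal_enorm, h1, ENNReal.toReal_one]
    exact h2
  · have h1 : ∀ n, ∫⁻ u in Ioo b 1, ‖ρ.rep (e n) u‖ₑ = ENNReal.ofReal (1 - b ^ (Λ n + 1)) := by
      intro n
      rw [← lintegral_Ioo_rpow (hpos n) hb]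
      refine setLIntegral_congr_fun measurableSet_Ioo fun x hx => ?_
      simp only [hrep n ⟨hb.1.trans hx.1.le, hx.2⟩]
    simp only [h1]
    have h2 : Tendsto (fun n => b ^ (Λ n + 1)) atTop (𝓝 0) :=
      (tendsto_rpow_atTop_of_base_lt_one b (by linarith [hb.1]) hb.2).comp
        (tendsto_atTop_add_const_right _ 1 (tendsto_atTop_of_summable_one_div hpos hsum))
    have h3 := ENNReal.tendsto_ofReal (h2.const_sub 1)
    simpa using h3

/-- Along a subsequence `K (e n)` converges to some `y`. Weak convergence of `e n` is not needed: by
absolute continuity of the integral, `y` has mass at most `η / 2` on `nearFibre φ δ` for small `δ`,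
while `T (e n)` keeps mass nearly `k - η / 2` there. -/
theorem le_norm_sub_of_isCompactOperator {Λ : ℕ → ℝ} (hpos : ∀ n, 0 < Λ n)
    (hsum : Summable fun n => 1 / Λ n) (ρ : MuntzRep Λ) {φ : ℝ → ℝ} (hφ : ConditionAlpha φ)
    {ψ : ℝ → ℂ} (hψ : ContinuousOn ψ (Icc 0 1)) {T : muntzSpace Λ →L[ℂ] L1Unit}
    (hT : IsWeightedComposition Λ φ ψ T) {K : muntzSpace Λ →L[ℂ] L1Unit}
    (hK : IsCompactOperator K) :
    ∑ x ∈ hφ.finite_fibre.toFinset, ‖ψ x‖ * reciprocalSlopes φ x ≤ ‖T - K‖ := by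
  set k := ∑ x ∈ hφ.finite_fibre.toFinset, ‖ψ x‖ * reciprocalSlopes φ x with hk
  obtain ⟨e, he, hlim⟩ := exists_normalized_powers hpos hsum ρ
  obtain ⟨C, hC, hKC⟩ := IsCompactOperator.image_closedBall_subset_compact
    (f := (K : muntzSpace Λ →ₗ[ℂ] L1Unit)) hK 1
  obtain ⟨y, -, ns, hns, hy⟩ := hC.tendsto_subseq (x := fun n => K (e n))
    fun n => hKC ⟨e n, by simp [he n], rfl⟩
  refine le_of_forall_pos_le_add fun η hη => ?_
  have hη2 : 0 < η / 2 := by positivity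
  have hyint : ∫⁻ x, ‖y x‖ₑ ∂unitMeasure ≠ ⊤ := by
    rw [← enorm_eq_lintegral_of_ae_eq (EventuallyEq.refl _ _)]
    exact enorm_ne_top
  have hsmall := (tendsto_setLIntegral_zero hyint (tendsto_volume_nearFibre hφ)).eventually
    (ge_mem_nhds (ENNReal.ofReal_pos.2 hη2))
  obtain ⟨δ, hN, hδ⟩ := ((eventually_pushforwardEstimate_nearFibre hφ hψ.norm
    (fun x => norm_nonneg _) hη2).and hsmall).exists
  obtain ⟨b, hb, hlow⟩ := hN.lower
  -- On `nearFibre φ δ`, `T (e n)` splits as `(T - K) (e n) + (K (e n) - y) + y`; only the last term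
  -- uses that the set is small.
  have hmain : ∀ n, ENNReal.ofReal (k - η / 2) * ∫⁻ u in Ioo b 1, ‖ρ.rep (e n) u‖ₑ ≤
      ‖T - K‖ₑ + ‖K (e n) - y‖ₑ + ENNReal.ofReal (η / 2) := by
    intro n
    have hen : ‖(T - K) (e n)‖ₑ ≤ ‖T - K‖ₑ := by
      have := (T - K).le_opNorm (e n)
      rw [he n, mul_one] at this
      rw [← ofReal_norm, ← ofReal_norm]
      exact ENNReal.ofReal_le_ofReal this
    have hset : ∀ f : L1Unit, ∫⁻ x in nearFibre φ δ, ‖f x‖ₑ ∂unitMeasure ≤ ‖f‖ₑ := by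
      intro f
      rw [enorm_eq_lintegral_of_ae_eq (EventuallyEq.refl _ _)]
      exact setLIntegral_le_lintegral _ _
    calc _ ≤ ∫⁻ x in nearFibre φ δ, ENNReal.ofReal ‖ψ x‖ * ‖ρ.rep (e n) (φ x)‖ₑ :=
          hlow fun u => ‖ρ.rep (e n) u‖ₑ
      _ = ∫⁻ x in nearFibre φ δ, ‖T (e n) x‖ₑ ∂unitMeasure := by
          rw [← unitMeasure_restrict_nearFibre]
          refine lintegral_congr_ae (ae_restrict_of_ae ?_)
          filter_upwards [hT.ae_eq_rep ρ hφ (e n)] with x hx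
          rw [hx, enorm_mul, ofReal_norm]
      _ ≤ ∫⁻ x in nearFibre φ δ, (‖((T - K) (e n) : L1Unit) x‖ₑ + ‖(K (e n) - y : L1Unit) x‖ₑ) +
            ‖y x‖ₑ ∂unitMeasure := by
          refine lintegral_mono_ae (ae_restrict_of_ae ?_)
          filter_upwards [Lp.coeFn_sub (T (e n)) (K (e n)), Lp.coeFn_sub (K (e n)) y]
            with x h1 h2
          rw [_root_.sub_apply, h1, h2, Pi.sub_apply, Pi.sub_apply]
          calc ‖T (e n) x‖ₑ = ‖(T (e n) x - K (e n) x + (K (e n) x - y x)) + y x‖ₑ := by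
                congr 1; ring
            _ ≤ _ := (enorm_add_le _ _).trans (by gcongr; exact enorm_add_le _ _)
      _ = (∫⁻ x in nearFibre φ δ, ‖((T - K) (e n) : L1Unit) x‖ₑ ∂unitMeasure +
            ∫⁻ x in nearFibre φ δ, ‖(K (e n) - y : L1Unit) x‖ₑ ∂unitMeasure) +
            ∫⁻ x in nearFibre φ δ, ‖y x‖ₑ ∂unitMeasure := by
          rw [lintegral_add_right' _ (Lp.aestronglyMeasurable y).enorm.restrict,
            lintegral_add_right' _ (Lp.aestronglyMeasurable (K (e n) - y)).enorm.restrict]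
      _ ≤ _ := add_le_add (add_le_add ((hset _).trans hen) (hset _)) hδ
  have hl := ENNReal.Tendsto.const_mul ((hlim b hb).comp hns.tendsto_atTop)
    (a := ENNReal.ofReal (k - η / 2)) (Or.inr ENNReal.ofReal_ne_top)
  have hy0 : Tendsto (fun j => ‖K (e (ns j)) - y‖ₑ) atTop (𝓝 0) := by
    have := (tendsto_iff_norm_sub_tendsto_zero.1 hy)
    have h2 := ENNReal.tendsto_ofReal this
    simpa [ofReal_norm] using h2
  have hr := (hy0.const_add ‖T - K‖ₑ).add_const (ENNReal.ofReal (η / 2))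
  have hfin := le_of_tendsto_of_tendsto' hl hr fun j => hmain (ns j)
  -- The comparison returns to `ℝ` although `k - η / 2` may be negative: only the right side has to
  -- be nonnegative.
  rw [mul_one, add_zero, ← ofReal_norm, ← ENNReal.ofReal_add (norm_nonneg _) hη2.le,
    ENNReal.ofReal_le_ofReal_iff (by positivity)] at hfin
  linarith

/-! ### Conclusion -/

theorem mainTheorem11 (Λ : ℕ → ℝ) (hΛ_mono : StrictMono Λ) (hΛ_pos : ∀ n, 0 < Λ n)
    (hΛ_sum : Summable fun n => 1 / Λ n)
    (φ : ℝ → ℝ) (hφ : ConditionAlpha φ)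
    (ψ : ℝ → ℂ) (hψ : ContinuousOn ψ (Set.Icc 0 1)) :
    (∃! T : muntzSpace Λ →L[ℂ] L1Unit, IsWeightedComposition Λ φ ψ T) ∧
    ∀ T : muntzSpace Λ →L[ℂ] L1Unit, IsWeightedComposition Λ φ ψ T →
      essentialNorm T =
        ∑ x ∈ hφ.finite_fibre.toFinset, ‖ψ x‖ * reciprocalSlopes φ x := by
  obtain ⟨ρ⟩ := nonempty_muntzRep hΛ_pos hΛ_sum
  refine ⟨?_, fun T hT => ?_⟩
  · obtain ⟨T, hT⟩ := exists_isWeightedComposition ρ hφ hψ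
    refine ⟨T, hT, fun T' hT' => ContinuousLinearMap.ext fun f => Lp.ext ?_⟩
    exact (hT'.ae_eq_rep ρ hφ f).trans (hT.ae_eq_rep ρ hφ f).symm
  -- A real infimum over an empty or unbounded-below family has the default value `0`, so
  -- nonemptiness and `BddBelow` are supplied explicitly.
  · have : Nonempty {K : muntzSpace Λ →L[ℂ] L1Unit // IsCompactOperator K} :=
      ⟨⟨0, isCompactOperator_zero⟩⟩
    refine le_antisymm (le_of_forall_pos_le_add fun η hη => ?_) (le_ciInf fun K =>
      le_norm_sub_of_isCompactOperator hΛ_pos hΛ_sum ρ hφ hψ hT K.2)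
    obtain ⟨K, hK, hTK⟩ := exists_compact_norm_sub_le ρ hφ hψ hT hη
    have hbdd : BddBelow (range fun K : {K : muntzSpace Λ →L[ℂ] L1Unit // IsCompactOperator K} =>
        ‖T - (K : muntzSpace Λ →L[ℂ] L1Unit)‖) := ⟨0, forall_mem_range.2 fun K => (T - K.1).opNorm_nonneg⟩
    exact (ciInf_le hbdd ⟨K, hK⟩).trans hTK
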